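/- Let $\chi_{-7}$ be the non-principal real character modulo $7$ (the Legendre symbol $(\cdot/7)$) and, with $q=e^{2\pi i\tau}$ and $\tau$ in the upper half plane, put $$\Psi_7(\chi_{-7},\tau)=\frac12\sum_{n\ge 1}\Big(\sum_{\substack{x,y\in\mathbb Z\\ x^2+7y^2=n}}\chi_{-7}(x)\,x\Big)q^n .$$ There is exactly one newform $G$ of weight $2$ on $\Gamma_0(49)$ with trivial character, that is, one normalised cusp form (first Fourier coefficient equal to $1$) in the new subspace of $S_2(\Gamma_0(49))$ that is an eigenform of all Hecke operators $T_p$; its LMFDB label is 49.2.a.a. For this $G$ and every $\tau$ in the upper half plane, the series $\Psi_7(\chi_{-7},\tau)$ converges absolutely and $$\Psi_7(\chi_{-7},\tau)=G(\tau)-G(2\tau)+4\,G(4\tau).$$ Consequently, for every odd prime $p\neq 7$ the $p$-th Fourier coefficient of $G$ equals $$\frac12\sum_{\substack{x,y\in\mathbb Z\\ x^2+7y^2=p}}\chi_{-7}(x)\,x .$$ -/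

import Mathlib

open UpperHalfPlane
open scoped MatrixGroups

noncomputable section

namespace CMTheta

/-! ### Newforms of weight `k` on `Γ₀(N)` with trivial character -/

/-- The congruence subgroup `Γ₀(N)`, viewed inside `GL₂(ℝ)`. -/
abbrev G0 (N : ℕ) : Subgroup (GL (Fin 2) ℝ) :=
  (CongruenceSubgroup.Gamma0 N).map (Matrix.SpecialLinearGroup.mapGL ℝ)

/-- The point `d τ` of the upper half plane, for a positive integer `d`. -/
def mulPt (d : ℕ+) (τ : ℍ) : ℍ :=
  ⟨((d : ℕ) : ℂ) * (τ : ℂ), by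
    have h : (0 : ℝ) < ((d : ℕ) : ℝ) := by exact_mod_cast d.pos
    simpa using mul_pos h τ.im_pos⟩

/-- The point `(τ + j) / d` of the upper half plane, for a positive integer `d`. -/
def divPt (d : ℕ+) (j : ℕ) (τ : ℍ) : ℍ :=
  ⟨((τ : ℂ) + (j : ℂ)) / ((d : ℕ) : ℂ), by
    have h : (0 : ℝ) < ((d : ℕ) : ℝ) := by exact_mod_cast d.pos
    rw [Complex.div_natCast_im]
    simpa using div_pos τ.im_pos h⟩

/-- The function `τ ↦ f (d τ)`; on `q`-series, `∑ a(n) qⁿ ↦ ∑ a(n) q^(d n)`. -/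
def dilate (d : ℕ+) (f : ℍ → ℂ) : ℍ → ℂ := fun τ => f (mulPt d τ)

/-- The Hecke operator `T_p` (`p` prime) in weight `k` and level `Γ₀(N)`. On `q`-series it sends
`∑ a(n) qⁿ` to `∑ (a(p n) + p^(k-1) a(n/p)) qⁿ`, the second term being absent if `p ∣ N`. -/
def heckeT (N : ℕ) (k : ℤ) (p : ℕ+) (f : ℍ → ℂ) : ℍ → ℂ := fun τ =>
  (((p : ℕ) : ℂ))⁻¹ * ∑ j ∈ Finset.range (p : ℕ), f (divPt p j τ) +
    if (p : ℕ) ∣ N then 0 else ((p : ℕ) : ℂ) ^ (k - 1) * dilate p f τ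

/-- The (unnormalised) Petersson inner product on `Γ₀(N)`: the integral of
`conj f · g · (im τ)^k` against the hyperbolic measure over the fundamental domain for `Γ₀(N)`
made of translates of the standard fundamental domain for `SL₂(ℤ)`. -/
def peterssonInner (N : ℕ) (k : ℤ) (f g : ℍ → ℂ) : ℂ :=
  ∑ᶠ c : SL(2, ℤ) ⧸ CongruenceSubgroup.Gamma0 N,
    ∫ τ in ModularGroup.fd, petersson k f g (c.out⁻¹ • τ)

/-- `f` lies in the new subspace of level `N`: it is orthogonal to every oldform `g(d τ)`, where
`g` is a cusp form on `Γ₀(M)` for a proper divisor `M` of `N` and `d` divides `N / M`. -/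
def IsNew (N : ℕ) (k : ℤ) (f : CuspForm (G0 N) k) : Prop :=
  ∀ (M : ℕ) (d : ℕ+), M * (d : ℕ) ∣ N → M ≠ N →
    ∀ g : CuspForm (G0 M) k, peterssonInner N k (dilate d g) f = 0

/-- The `n`-th Fourier coefficient of `f` at the cusp `∞`. -/
def fourierCoeff (f : ℍ → ℂ) (n : ℕ) : ℂ := (qExpansion 1 f).coeff n

/-- A newform: a normalised cusp form in the new subspace that is an eigenvector of all `T_p`. -/
structure IsNewform (N : ℕ) (k : ℤ) (f : CuspForm (G0 N) k) : Prop where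
  isNew : IsNew N k f
  eigen : ∀ p : ℕ+, (p : ℕ).Prime → ∃ c : ℂ, ∀ τ : ℍ, heckeT N k p f τ = c * f τ
  normalised : fourierCoeff f 1 = 1

/-! ### The theta-type series -/

/-- The integral solutions `(x, y)` of `x² + k y² = n`, for `k ≥ 1`. -/
def reps (k n : ℕ) : Finset (ℤ × ℤ) :=
  (Finset.Icc (-(n : ℤ)) n ×ˢ Finset.Icc (-(n : ℤ)) n).filter
    fun z => z.1 ^ 2 + (k : ℤ) * z.2 ^ 2 = n

theorem mem_reps {k : ℕ} (hk : 1 ≤ k) (n : ℕ) (z : ℤ × ℤ) :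
    z ∈ reps k n ↔ z.1 ^ 2 + (k : ℤ) * z.2 ^ 2 = n := by
  unfold reps
  simp only [Finset.mem_filter, Finset.mem_product, Finset.mem_Icc, and_iff_right_iff_imp]
  intro h
  have hk' : (1 : ℤ) ≤ k := by exact_mod_cast hk
  have hx : z.1 ^ 2 ≤ n := by nlinarith [sq_nonneg z.2]
  have hy : z.2 ^ 2 ≤ n := by nlinarith [sq_nonneg z.1, sq_nonneg z.2]
  have key : ∀ t : ℤ, t ^ 2 ≤ n → -(n : ℤ) ≤ t ∧ t ≤ n := by
    intro t ht
    have h1 := Int.le_self_sq t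
    have h2 := Int.le_self_sq (-t)
    rw [neg_sq] at h2
    constructor <;> linarith
  exact ⟨key _ hx, key _ hy⟩

/-- `½ ∑_{x² + k y² = n} χ(x) x`. -/
def psiCoeff {m : ℕ} (k : ℕ) (χ : DirichletCharacter ℂ m) (n : ℕ) : ℂ :=
  1 / 2 * ∑ z ∈ reps k n, χ (z.1 : ZMod m) * (z.1 : ℂ)

/-- The nome `q = exp(2 π i τ)`. -/
def nome (τ : ℍ) : ℂ := Complex.exp (2 * Real.pi * Complex.I * τ)

/-- `Ψ_k(χ, τ) = ½ ∑_{n ≥ 1} (∑_{x² + k y² = n} χ(x) x) qⁿ`. -/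
def Psi {m : ℕ} (k : ℕ) (χ : DirichletCharacter ℂ m) (τ : ℍ) : ℂ :=
  ∑' n : ℕ, psiCoeff k χ (n + 1) * nome τ ^ (n + 1)

instance factPrimeSeven : Fact (Nat.Prime 7) := ⟨by norm_num⟩

/-- The non-principal real character modulo `7`, that is the Legendre symbol `(· / 7)`. -/
def chi7 : DirichletCharacter ℂ 7 :=
  (quadraticChar (ZMod 7)).ringHomComp (Int.castRingHom ℂ)

end CMTheta

end

open UpperHalfPlane
open scoped MatrixGroups

noncomputable section

namespace CMTheta

/-! ### The Weil representation of `SL₂` on functions on `ℤ/7` -/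

/-! The candidate for the newform is the CM form `formG` = ½ ∑ χ(α) α q^N(α), over α in O = ℤ[(1 +
√-7)/2], where χ is the Legendre symbol of α modulo √-7. Four facts about it suffice.

Modularity. For a function φ on ℤ/7, the series `theta φ` weighted by Re(α) is modular of weight 2
for the whole of SL₂(ℤ), acting on φ through the Weil representation of the form x²/7
(`thetaH_slash`). The action of T is a congruence for the norm; that of S is Poisson summation,
obtained from the functional equation of the Jacobi theta function. The function `chi7` is fixed by
the matrices diagonal modulo 7, and conjugation by diag(7, 1) carries the group `D7` of these
matrices to Γ₀(49).

One-dimensionality. A weight 2 cusp form on `D7` that vanishes to order 2 in exp(2πiτ/7) at ∞ is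
zero (`eq_zero_of_isBigO`). Its norm to level one is a product of 56 translates, of weight 112. Each
translate vanishes to order at least 1 in exp(2πiτ/7), and seven of them to order 2, so the norm
vanishes to order 63/7 = 9 and equals c Δ⁹E₄. Two translates vanish at the elliptic point ρ, whereas
the zeros of E₄ are simple; hence c = 0. Consequently a cusp form on Γ₀(49) is determined by its
first coefficient, which gives uniqueness. The same bound shows that there are no cusp forms of
weight 2 and level 1 or 7, so being new is automatic.

Hecke eigenvalues. Both χ and α are multiplicative, so the part of the lattice sum over multiples of
η is χ(η)η times the sum at N(η)τ (`hasSum_latTerm_dvd`). The operator T_p first selects the α with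
p ∣ N(α). For p split as ππ̄, inclusion-exclusion over π and π̄ leaves the term at pτ, which the
second term of T_p cancels; for p inert the same cancellation gives eigenvalue 0; for p = 7 the
character kills every term.

The identity. The suborder ℤ[√-7] is cut out of O by inclusion-exclusion at the split prime 2 = ωω̄:
its indicator is 1 - [ω ∣ α] - [ω̄ ∣ α] + 2[2 ∣ α]. Since χ(ω)ω + χ(ω̄)ω̄ = 1 and χ(2)·2 = 2, this
yields the coefficients 1, -1, 4. At odd indices the dilated terms contribute nothing. -/

/-- The additive character `x ↦ exp (2 π i x / 7)` of `ℤ/7`. -/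
abbrev e7 : AddChar (ZMod 7) ℂ := ZMod.stdAddChar

theorem e7_natCast (j : ℕ) : e7 (j : ZMod 7) = Complex.exp (2 * Real.pi * Complex.I * j / 7) := by
  have := ZMod.stdAddChar_coe (N := 7) (j : ℤ)
  push_cast at this
  exact this

theorem e7_intCast (j : ℤ) : e7 (j : ZMod 7) = Complex.exp (2 * Real.pi * Complex.I * j / 7) := by
  have := ZMod.stdAddChar_coe (N := 7) j
  push_cast at this
  exact this

theorem sum_univ_zmod_seven (f : ZMod 7 → ℂ) :
    ∑ x, f x = f 0 + f 1 + f 2 + f 3 + f 4 + f 5 + f 6 :=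
  Fin.sum_univ_seven f

theorem e7_sum_mul (b : ZMod 7) : ∑ x, e7 (x * b) = if b = 0 then 7 else 0 := by
  have h := AddChar.sum_mulShift b (ZMod.isPrimitive_stdAddChar 7)
  rw [ZMod.card 7] at h
  exact_mod_cast h

theorem e7_sum_eq_zero : 1 + e7 1 + e7 2 + e7 3 + e7 4 + e7 5 + e7 6 = 0 := by
  have h := e7_sum_mul 1
  simp only [mul_one, sum_univ_zmod_seven, AddChar.map_zero_eq_one] at h
  simpa using h

/-- The quadratic Gauss sum modulo `7`. -/
def gauss7 : ℂ := 1 + 2 * (e7 1 + e7 2 + e7 4)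

theorem e7_mul (a b : ZMod 7) : e7 a * e7 b = e7 (a + b) := (AddChar.map_add_eq_mul e7 a b).symm

theorem gauss7_sq : gauss7 ^ 2 = -7 := by
  have h := e7_sum_eq_zero
  have h2 := e7_mul 1 1
  have h3 := e7_mul 1 2
  have h4 := e7_mul 1 4
  have h5 := e7_mul 2 2
  have h6 := e7_mul 2 4
  have h8 := e7_mul 4 4
  norm_num at h2 h3 h4 h5 h6 h8
  have r1 : (8 : ZMod 7) = 1 := by decide
  rw [r1] at h8
  unfold gauss7
  linear_combination 4 * h2 + 4 * h5 + 4 * h8 + 8 * h3 + 8 * h4 + 8 * h6 + 8 * h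

/-- The square fixes the sum up to sign. The sign is decided by the imaginary part, which is
positive because sin(8π/7) = -sin(π/7) is outweighed by sin(2π/7). -/
theorem gauss7_eq : gauss7 = Complex.I * Real.sqrt 7 := by
  have hs : ((Real.sqrt 7 : ℝ) : ℂ) ^ 2 = 7 := by
    rw [← Complex.ofReal_pow, Real.sq_sqrt (by norm_num)]; norm_num
  have h : (gauss7 - Complex.I * Real.sqrt 7) * (gauss7 + Complex.I * Real.sqrt 7) = 0 := by
    linear_combination gauss7_sq - Complex.I ^ 2 * hs - 7 * Complex.I_sq
  rcases mul_eq_zero.mp h with h | h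
  · exact sub_eq_zero.mp h
  · exfalso
    have him : ∀ j : ℕ, (e7 (j : ZMod 7)).im = Real.sin (2 * Real.pi * j / 7) := by
      intro j
      rw [e7_natCast, show (2 * Real.pi * Complex.I * j / 7 : ℂ)
        = ((2 * Real.pi * j / 7 : ℝ) : ℂ) * Complex.I by push_cast; ring,
        Complex.exp_ofReal_mul_I_im]
    have hpi := Real.pi_pos
    have s2 : 0 < Real.sin (2 * Real.pi * (2 : ℕ) / 7) := by
      apply Real.sin_pos_of_pos_of_lt_pi <;> push_cast <;> linarith
    have s4 : Real.sin (2 * Real.pi * (4 : ℕ) / 7) = -Real.sin (Real.pi / 7) := by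
      rw [show 2 * Real.pi * ((4 : ℕ) : ℝ) / 7 = Real.pi / 7 + Real.pi by push_cast; ring,
        Real.sin_add_pi]
    have s1 : Real.sin (Real.pi / 7) < Real.sin (2 * Real.pi * (1 : ℕ) / 7) := by
      apply Real.sin_lt_sin_of_lt_of_le_pi_div_two <;> push_cast <;> linarith
    have e : gauss7.im = 2 * ((e7 ((1 : ℕ) : ZMod 7)).im + (e7 ((2 : ℕ) : ZMod 7)).im
        + (e7 ((4 : ℕ) : ZMod 7)).im) := by
      simp [gauss7]
    rw [him, him, him, s4] at e
    have hre := congrArg Complex.im h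
    simp only [Complex.add_im, Complex.mul_im, Complex.I_re, Complex.I_im, Complex.ofReal_im,
      Complex.ofReal_re, Complex.zero_im] at hre
    have := Real.sqrt_nonneg 7
    linarith

theorem gauss7_ne_zero : gauss7 ≠ 0 := fun h => by
  have := gauss7_sq
  rw [h] at this
  norm_num at this

theorem gauss7_inv_sq : gauss7⁻¹ ^ 2 * 7 = -1 := by
  rw [inv_pow, gauss7_sq]; norm_num

theorem chi7_apply (x : ZMod 7) : chi7 x = ((quadraticChar (ZMod 7) x : ℤ) : ℂ) := rfl

theorem chi7_values : chi7 0 = 0 ∧ chi7 1 = 1 ∧ chi7 2 = 1 ∧ chi7 3 = -1 ∧ chi7 4 = 1 ∧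
    chi7 5 = -1 ∧ chi7 6 = -1 := by
  have h : quadraticChar (ZMod 7) 0 = 0 ∧ quadraticChar (ZMod 7) 1 = 1 ∧
      quadraticChar (ZMod 7) 2 = 1 ∧ quadraticChar (ZMod 7) 3 = -1 ∧
      quadraticChar (ZMod 7) 4 = 1 ∧ quadraticChar (ZMod 7) 5 = -1 ∧
      quadraticChar (ZMod 7) 6 = -1 := by decide
  simp only [chi7_apply, h, Int.cast_zero, Int.cast_one, Int.cast_neg, and_self]

theorem chi7_neg (x : ZMod 7) : chi7 (-x) = -chi7 x := by
  rw [neg_eq_neg_one_mul, map_mul, show (-1 : ZMod 7) = 6 from rfl, chi7_values.2.2.2.2.2.2]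
  ring

theorem chi7_sq {x : ZMod 7} (hx : x ≠ 0) : chi7 x * chi7 x = 1 := by
  rw [chi7_apply]
  have := quadraticChar_sq_one hx
  rw [sq] at this
  exact_mod_cast this

theorem chi7_inv (x : ZMod 7) : chi7 x⁻¹ = chi7 x := by
  by_cases hx : x = 0
  · simp [hx]
  · have h1 : chi7 x⁻¹ * chi7 x = 1 := by rw [← map_mul, inv_mul_cancel₀ hx, map_one]
    linear_combination chi7 x * h1 - chi7 x⁻¹ * chi7_sq hx

theorem e7_sum_mul_sq {A : ZMod 7} (hA : A ≠ 0) : ∑ y, e7 (A * y ^ 2) = chi7 A * gauss7 := by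
  have h := e7_sum_eq_zero
  obtain ⟨-, c1, c2, c3, c4, c5, c6⟩ := chi7_values
  have hA' : A = 1 ∨ A = 2 ∨ A = 3 ∨ A = 4 ∨ A = 5 ∨ A = 6 := by
    revert A; decide
  have key : ∀ B : ZMod 7, ∑ y, e7 (B * y ^ 2) = 1 + 2 * (e7 B + e7 (B * 2) + e7 (B * 4)) := by
    intro B
    rw [sum_univ_zmod_seven]
    simp only [show (0 : ZMod 7) ^ 2 = 0 from rfl, show (1 : ZMod 7) ^ 2 = 1 from rfl,
      show (2 : ZMod 7) ^ 2 = 4 from rfl, show (3 : ZMod 7) ^ 2 = 2 from rfl,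
      show (4 : ZMod 7) ^ 2 = 2 from rfl, show (5 : ZMod 7) ^ 2 = 4 from rfl,
      show (6 : ZMod 7) ^ 2 = 1 from rfl, mul_zero, mul_one, AddChar.map_zero_eq_one]
    ring
  rw [key]
  unfold gauss7
  rcases hA' with rfl | rfl | rfl | rfl | rfl | rfl
  · rw [c1]; simp
  · rw [c2, show (2 * 2 : ZMod 7) = 4 from rfl, show (2 * 4 : ZMod 7) = 1 from rfl]; ring
  · rw [c3, show (3 * 2 : ZMod 7) = 6 from rfl, show (3 * 4 : ZMod 7) = 5 from rfl]
    linear_combination 2 * h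
  · rw [c4, show (4 * 2 : ZMod 7) = 1 from rfl, show (4 * 4 : ZMod 7) = 2 from rfl]; ring
  · rw [c5, show (5 * 2 : ZMod 7) = 3 from rfl, show (5 * 4 : ZMod 7) = 6 from rfl]
    linear_combination 2 * h
  · rw [c6, show (6 * 2 : ZMod 7) = 5 from rfl, show (6 * 4 : ZMod 7) = 3 from rfl]
    linear_combination 2 * h

theorem e7_quadratic_sum {A : ZMod 7} (hA : A ≠ 0) (B : ZMod 7) :
    ∑ y, e7 (A * y ^ 2 + 2 * B * y) = chi7 A * gauss7 * e7 (-B ^ 2 / A) := by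
  have h := Equiv.sum_comp (Equiv.addRight (B / A)) fun y => e7 (A * y ^ 2) * e7 (-B ^ 2 / A)
  rw [← e7_sum_mul_sq hA, Finset.sum_mul, ← h]
  refine Finset.sum_congr rfl fun y _ => ?_
  rw [e7_mul]
  congr 1
  simp only [Equiv.coe_addRight]
  field_simp
  ring

/-- The Weil representation attached to the quadratic form `x² / 7` on `ℤ/7`: the action of the
matrix `(a b; c d)` on functions on `ℤ/7`. -/
def weil (a b c d : ZMod 7) (φ : ZMod 7 → ℂ) (x : ZMod 7) : ℂ :=
  if c = 0 then chi7 d * e7 (b * d * x ^ 2) * φ (d * x)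
  else gauss7⁻¹ * chi7 c * ∑ y, e7 ((d * x ^ 2 - 2 * x * y + a * y ^ 2) / c) * φ y

theorem weil_mul_T {a b c d : ZMod 7} (h : a * d - b * c = 1) (φ : ZMod 7 → ℂ) (x : ZMod 7) :
    weil a (a + b) c (c + d) φ x = e7 (x ^ 2) * weil a b c d φ x := by
  unfold weil
  split_ifs with hc
  · subst hc
    rw [zero_add, show (a + b) * d * x ^ 2 = x ^ 2 + b * d * x ^ 2 by
      linear_combination x ^ 2 * h, ← e7_mul]
    ring
  · rw [mul_left_comm]
    congr 1
    rw [Finset.mul_sum]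
    refine Finset.sum_congr rfl fun y _ => ?_
    rw [← mul_assoc, e7_mul]
    congr 2
    field_simp
    ring

/-- Together with `weil_mul_T`, this makes `weil` compatible with right multiplication by
generators, which is all that is needed of the representation property. The generic case is a
completed square; if c = 0 only a reindexing by d is needed. -/
theorem weil_mul_S {a b c d : ZMod 7} (h : a * d - b * c = 1) (φ : ZMod 7 → ℂ) (z : ZMod 7) :
    weil b (-a) d (-c) φ z = gauss7⁻¹ * ∑ x, e7 (-2 * x * z) * weil a b c d φ x := by
  have hg := gauss7_ne_zero
  by_cases hc : c = 0
  · subst hc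
    have hd : d ≠ 0 := by rintro rfl; simp at h
    simp only [weil, if_true, if_neg hd, neg_zero, mul_assoc]
    congr 1
    rw [Finset.mul_sum, ← Equiv.sum_comp (Equiv.mulLeft₀ d hd)]
    refine Finset.sum_congr rfl fun x _ => ?_
    simp only [Equiv.mulLeft₀_apply]
    rw [mul_left_comm (e7 _), ← mul_assoc (e7 (-2 * (x * z))), e7_mul]
    congr 3
    field_simp
    ring
  · simp only [weil, if_neg hc]
    have step : ∑ x, e7 (-2 * x * z) * (gauss7⁻¹ * chi7 c *
          ∑ y, e7 ((d * x ^ 2 - 2 * x * y + a * y ^ 2) / c) * φ y)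
        = gauss7⁻¹ * chi7 c * ∑ y, e7 (a * y ^ 2 / c) * φ y *
          ∑ x, e7 (d / c * x ^ 2 + 2 * (-(z + y / c)) * x) := by
      simp only [Finset.mul_sum]
      rw [Finset.sum_comm]
      refine Finset.sum_congr rfl fun y _ => Finset.sum_congr rfl fun x _ => ?_
      have : e7 (-2 * x * z) * e7 ((d * x ^ 2 - 2 * x * y + a * y ^ 2) / c)
          = e7 (a * y ^ 2 / c) * e7 (d / c * x ^ 2 + 2 * (-(z + y / c)) * x) := by
        rw [e7_mul, e7_mul]
        congr 1
        field_simp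
        ring
      linear_combination gauss7⁻¹ * chi7 c * φ y * this
    rw [step]
    split_ifs with hd
    -- With d = 0 the quadratic term in x disappears, and orthogonality of characters replaces the
    -- Gauss sum: only y = -cz survives, with factor 7, absorbed by 7 · `gauss7`⁻² = -1.
    · subst hd
      have hbc : b * c = -1 := by linear_combination -h
      have : ∀ y, ∑ x, e7 (0 / c * x ^ 2 + 2 * (-(z + y / c)) * x)
          = if y = -c * z then 7 else 0 := by
        intro y
        simp only [zero_div, zero_mul, zero_add, mul_comm (2 * -(z + y / c))]
        rw [e7_sum_mul]
        have h2 : (2 : ZMod 7) ≠ 0 := by decide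
        refine if_congr ?_ rfl rfl
        rw [mul_eq_zero]
        constructor
        · rintro (h' | h')
          · exact absurd h' h2
          · field_simp at h'
            linear_combination -h'
        · rintro rfl
          right
          field_simp
          ring
      simp only [this, mul_ite, mul_zero, Finset.sum_ite_eq', Finset.mem_univ, if_true]
      rw [chi7_neg, show -a * -c * z ^ 2 = a * (-c * z) ^ 2 / c by field_simp]
      linear_combination (-chi7 c * e7 (a * (-c * z) ^ 2 / c) * φ (-c * z)) * gauss7_inv_sq
    · have hdc : d / c ≠ 0 := div_ne_zero hd hc
      simp only [e7_quadratic_sum hdc]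
      simp only [Finset.mul_sum]
      refine Finset.sum_congr rfl fun y _ => ?_
      have h1 : e7 ((-c * z ^ 2 - 2 * z * y + b * y ^ 2) / d)
          = e7 (a * y ^ 2 / c) * e7 (-(-(z + y / c)) ^ 2 / (d / c)) := by
        rw [e7_mul]
        congr 1
        field_simp
        linear_combination (-y ^ 2) * h
      have h2 : chi7 (d / c) = chi7 d * chi7 c := by rw [div_eq_mul_inv, map_mul, chi7_inv]
      rw [h1, h2]
      have h3 := chi7_sq hc
      have h4 : gauss7 * gauss7⁻¹ = 1 := mul_inv_cancel₀ hg
      generalize e7 (-(-(z + y / c)) ^ 2 / (d / c)) = E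
      linear_combination (-(gauss7⁻¹ * chi7 d * e7 (a * y ^ 2 / c) * φ y * E)) * h3 -
        gauss7⁻¹ * chi7 c ^ 2 * chi7 d * e7 (a * y ^ 2 / c) * φ y * E * h4

theorem hasSum_of_eq {ι : Type*} {f g : ι → ℂ} {a b : ℂ} (h : HasSum f a) (hf : ∀ i, g i = f i)
    (ha : b = a) : HasSum g b := by
  rw [ha, funext hf]
  exact h

/-! ### Theta series of the order `ℤ[(1 + √-7) / 2]` -/

/-- The norm form `u² + u v + 2 v²` of `u + v (1 + √-7) / 2`. -/
def normForm (z : ℤ × ℤ) : ℤ := z.1 ^ 2 + z.1 * z.2 + 2 * z.2 ^ 2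

/-- The general term of `theta`. -/
def thetaTerm (φ : ZMod 7 → ℂ) (τ : ℂ) (z : ℤ × ℤ) : ℂ :=
  φ ((z.1 + 4 * z.2 : ℤ) : ZMod 7) * (z.1 + z.2 / 2) *
    Complex.exp (2 * Real.pi * Complex.I * τ * normForm z / 7)

/-- The theta series `∑ φ(α) Re(α) exp (2 π i τ N(α) / 7)` over `α = u + v (1 + √-7) / 2`, where
`φ` is evaluated at the residue `u + 4 v` of `α` modulo `√-7`. -/
def theta (φ : ZMod 7 → ℂ) (τ : ℂ) : ℂ := ∑' z, thetaTerm φ τ z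

/-! ### One-variable theta functions of residue classes -/

theorem summable_twisted_linear {τ : ℂ} (hτ : 0 < τ.im) (z : ℂ) :
    Summable fun n : ℤ => (n : ℂ) * Complex.exp (2 * Real.pi * Complex.I * n * z +
      Real.pi * Complex.I * n ^ 2 * τ) := by
  have h := ((summable_jacobiTheta₂'_term_iff z τ).mpr hτ).mul_left (2 * Real.pi * Complex.I)⁻¹
  refine h.congr fun n => ?_
  have := Complex.two_pi_I_ne_zero
  simp only [jacobiTheta₂'_term, jacobiTheta₂_term]
  field_simp

theorem summable_twisted {τ : ℂ} (hτ : 0 < τ.im) (z : ℂ) :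
    Summable fun n : ℤ => Complex.exp (2 * Real.pi * Complex.I * n * z +
      Real.pi * Complex.I * n ^ 2 * τ) :=
  (summable_jacobiTheta₂_term_iff z τ).mpr hτ

theorem ne_zero_of_im_pos {τ : ℂ} (hτ : 0 < τ.im) : τ ≠ 0 := by
  rintro rfl; simp at hτ

theorem neg_one_div_im_pos {τ : ℂ} (hτ : 0 < τ.im) : 0 < (-1 / τ).im := by
  rw [div_eq_mul_inv, neg_one_mul, Complex.neg_im, Complex.inv_im, neg_div, neg_neg]
  exact div_pos hτ (Complex.normSq_pos.mpr (ne_zero_of_im_pos hτ))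

theorem residue_exponent {τ : ℂ} (hτ : τ ≠ 0) {M : ℕ} (hM : 0 < M) (l n : ℤ) :
    -Real.pi * Complex.I * (l / M : ℂ) ^ 2 / (τ / M) + (2 * Real.pi * Complex.I * n *
      (l / M / (τ / M)) + Real.pi * Complex.I * n ^ 2 * (-1 / (τ / M))) =
    Real.pi * Complex.I * (M * (-n : ℤ) + l) ^ 2 * (-1 / τ) / M := by
  have hM' : (M : ℂ) ≠ 0 := by exact_mod_cast hM.ne'
  push_cast
  field_simp
  ring

/-- The theta function of a residue class, and its functional equation. -/
theorem hasSum_residue {τ : ℂ} (hτ : 0 < τ.im) {M : ℕ} (hM : 0 < M) (l : ℤ) :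
    HasSum (fun n : ℤ => Complex.exp (Real.pi * Complex.I * (M * n + l) ^ 2 * (-1 / τ) / M))
      ((-Complex.I * (τ / M)) ^ (1 / 2 : ℂ) * ∑' n : ℤ, Complex.exp (2 * Real.pi * Complex.I * n *
        (l / M) + Real.pi * Complex.I * n ^ 2 * (τ / M))) := by
  have hM' : (M : ℂ) ≠ 0 := by exact_mod_cast hM.ne'
  have hτ0 := ne_zero_of_im_pos hτ
  have hτM : 0 < (τ / M).im := by
    rw [Complex.div_natCast_im]
    exact div_pos hτ (by exact_mod_cast hM)
  have hne : (-Complex.I * (τ / M)) ^ (1 / 2 : ℂ) ≠ 0 := by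
    rw [Complex.cpow_ne_zero_iff]
    exact Or.inl (mul_ne_zero (neg_ne_zero.mpr Complex.I_ne_zero) (div_ne_zero hτ0 hM'))
  have h := jacobiTheta₂_functional_equation (l / M) (τ / M)
  have hs := (summable_twisted (neg_one_div_im_pos hτM) (l / M / (τ / M))).hasSum.mul_left
    (Complex.exp (-Real.pi * Complex.I * (l / M : ℂ) ^ 2 / (τ / M)))
  simp only [← Complex.exp_add, residue_exponent hτ0 hM] at hs
  rw [← (Equiv.neg ℤ).hasSum_iff] 
  refine hasSum_of_eq hs (fun _ => rfl) ?_
  change _ * jacobiTheta₂ _ _ = _ * jacobiTheta₂ _ _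
  rw [h]
  generalize (-Complex.I * (τ / M)) ^ (1 / 2 : ℂ) = C at hne ⊢
  generalize jacobiTheta₂ (l / M / (τ / M)) (-1 / (τ / M)) = Z
  field_simp

/-- The weighted analogue of `hasSum_residue`: it combines the functional equations of the Jacobi
theta function and of its derivative in z. -/
theorem hasSum_residue_linear {τ : ℂ} (hτ : 0 < τ.im) {M : ℕ} (hM : 0 < M) (l : ℤ) :
    HasSum (fun n : ℤ => (M * n + l : ℂ) *
        Complex.exp (Real.pi * Complex.I * (M * n + l) ^ 2 * (-1 / τ) / M))
      (-τ * (-Complex.I * (τ / M)) ^ (1 / 2 : ℂ) * ∑' n : ℤ, (n : ℂ) *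
        Complex.exp (2 * Real.pi * Complex.I * n * (l / M) +
          Real.pi * Complex.I * n ^ 2 * (τ / M))) := by
  have hM' : (M : ℂ) ≠ 0 := by exact_mod_cast hM.ne'
  have hτ0 := ne_zero_of_im_pos hτ
  have hτM : 0 < (τ / M).im := by
    rw [Complex.div_natCast_im]
    exact div_pos hτ (by exact_mod_cast hM)
  have hne : (-Complex.I * (τ / M)) ^ (1 / 2 : ℂ) ≠ 0 := by
    rw [Complex.cpow_ne_zero_iff]
    exact Or.inl (mul_ne_zero (neg_ne_zero.mpr Complex.I_ne_zero) (div_ne_zero hτ0 hM'))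
  have hpi := Complex.two_pi_I_ne_zero
  have h := jacobiTheta₂'_functional_equation (l / M) (τ / M)
  have hs1 := (summable_twisted_linear (neg_one_div_im_pos hτM) (l / M / (τ / M))).hasSum
  have hs0 := (summable_twisted (neg_one_div_im_pos hτM) (l / M / (τ / M))).hasSum
  -- The combination is chosen so that -M(n - l/M) = M(-n) + l; the sign of n is then removed by
  -- reindexing.
  have hs := ((hs1.sub (hs0.mul_left (l / M : ℂ))).mul_left
    (Complex.exp (-Real.pi * Complex.I * (l / M : ℂ) ^ 2 / (τ / M)))).mul_left (-M : ℂ)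
  have hd : ∀ z τ : ℂ, jacobiTheta₂' z τ = 2 * Real.pi * Complex.I * ∑' n : ℤ, (n : ℂ) *
      Complex.exp (2 * Real.pi * Complex.I * n * z + Real.pi * Complex.I * n ^ 2 * τ) := by
    intro z τ
    rw [jacobiTheta₂', ← tsum_mul_left]
    refine tsum_congr fun n => ?_
    simp only [jacobiTheta₂'_term, jacobiTheta₂_term]
    ring
  rw [hd, hd] at h
  rw [← (Equiv.neg ℤ).hasSum_iff]
  refine hasSum_of_eq hs (fun n => ?_) ?_
  · simp only [Function.comp_apply, Equiv.neg_apply]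
    rw [← residue_exponent hτ0 hM, Complex.exp_add]
    push_cast
    field_simp
    ring
  · change _ = _ * (_ * (_ - _ * jacobiTheta₂ _ _))
    generalize (∑' n : ℤ, (n : ℂ) * Complex.exp (2 * Real.pi * Complex.I * n * (l / M : ℂ) +
      Real.pi * Complex.I * n ^ 2 * (τ / M))) = X at h ⊢
    generalize (∑' n : ℤ, (n : ℂ) * Complex.exp (2 * Real.pi * Complex.I * n *
      (l / M / (τ / M) : ℂ) + Real.pi * Complex.I * n ^ 2 * (-1 / (τ / M)))) = Y at h ⊢
    generalize jacobiTheta₂ (l / M / (τ / M)) (-1 / (τ / M)) = Z at h ⊢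
    generalize Complex.exp (-Real.pi * Complex.I * (l / M : ℂ) ^ 2 / (τ / M)) = E at h ⊢
    generalize (-Complex.I * (τ / M)) ^ (1 / 2 : ℂ) = C at h hne ⊢
    apply mul_left_cancel₀ hpi
    rw [show 2 * Real.pi * Complex.I * (-τ * C * X) = -τ * C * (2 * Real.pi * Complex.I * X) by
      ring, h]
    field_simp

/-! ### Reduction of the lattice sum to products of one-variable sums -/

theorem exp_pi_int_of_even {n : ℤ} (h : Even n) : Complex.exp (Real.pi * Complex.I * n) = 1 := by
  obtain ⟨k, rfl⟩ := h
  rw [← Complex.exp_int_mul_two_pi_mul_I k]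
  congr 1
  push_cast
  ring

theorem exp_pi_int_of_odd {n : ℤ} (h : Odd n) : Complex.exp (Real.pi * Complex.I * n) = -1 := by
  obtain ⟨k, rfl⟩ := h
  rw [show (Real.pi * Complex.I * (2 * k + 1 : ℤ) : ℂ)
    = k * (2 * Real.pi * Complex.I) + Real.pi * Complex.I by push_cast; ring,
    Complex.exp_add, Complex.exp_int_mul_two_pi_mul_I, Complex.exp_pi_mul_I, one_mul]

/-- The coordinates `(2 u + v, v)` of `u + v (1 + √-7) / 2` with respect to `1 / 2`, `√-7 / 2`. -/
def halfCoord (z : ℤ × ℤ) : ℤ × ℤ := (2 * z.1 + z.2, z.2)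

theorem halfCoord_injective : Function.Injective halfCoord := by
  rintro ⟨a, b⟩ ⟨c, d⟩ h
  simp only [halfCoord, Prod.mk.injEq] at h ⊢
  omega

theorem mem_range_halfCoord {p : ℤ × ℤ} : p ∈ Set.range halfCoord ↔ Even (p.1 + p.2) := by
  constructor
  · rintro ⟨z, rfl⟩
    exact ⟨z.1 + z.2, by simp only [halfCoord]; ring⟩
  · rintro ⟨k, hk⟩
    exact ⟨(k - p.2, p.2), by ext <;> simp only [halfCoord]; omega⟩

/-- The Gaussian `exp (2 π i τ (a² + 7 b²) / 28)`. -/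
def gaussian (τ : ℂ) (p : ℤ × ℤ) : ℂ :=
  Complex.exp (Real.pi * Complex.I * τ * (p.1 ^ 2 + 7 * p.2 ^ 2) / 14)

theorem gaussian_halfCoord (τ : ℂ) (z : ℤ × ℤ) :
    gaussian τ (halfCoord z) = Complex.exp (2 * Real.pi * Complex.I * τ * normForm z / 7) := by
  unfold gaussian halfCoord normForm
  congr 1
  push_cast
  ring

theorem thetaTerm_eq (φ : ZMod 7 → ℂ) (τ : ℂ) (z : ℤ × ℤ) :
    2 * thetaTerm φ τ z = φ (4 * (halfCoord z).1) * (halfCoord z).1 * gaussian τ (halfCoord z) := by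
  have h : ((z.1 + 4 * z.2 : ℤ) : ZMod 7) = 4 * ((halfCoord z).1 : ZMod 7) := by
    have h7 : (7 : ZMod 7) = 0 := rfl
    simp only [halfCoord]
    push_cast
    linear_combination (-z.1 : ZMod 7) * h7
  rw [gaussian_halfCoord, ← h, thetaTerm]
  simp only [halfCoord]
  push_cast
  ring

theorem hasSum_mul_int {f g : ℤ → ℂ} (hf : Summable f) (hg : Summable g) :
    HasSum (fun p : ℤ × ℤ => f p.1 * g p.2) ((∑' n, f n) * ∑' n, g n) :=
  hf.hasSum.mul hg.hasSum (summable_mul_of_summable_norm hf.norm hg.norm)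

theorem hasSum_twisted_mul {τ : ℂ} (hτ : 0 < τ.im) (z w : ℂ) :
    HasSum (fun p : ℤ × ℤ => ((p.1 : ℂ) * Complex.exp (2 * Real.pi * Complex.I * p.1 * z +
        Real.pi * Complex.I * p.1 ^ 2 * (τ / (14 : ℕ)))) *
        Complex.exp (2 * Real.pi * Complex.I * p.2 * w +
          Real.pi * Complex.I * p.2 ^ 2 * (τ / (2 : ℕ))))
      ((∑' n : ℤ, (n : ℂ) * Complex.exp (2 * Real.pi * Complex.I * n * z +
          Real.pi * Complex.I * n ^ 2 * (τ / (14 : ℕ)))) *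
        ∑' n : ℤ, Complex.exp (2 * Real.pi * Complex.I * n * w +
          Real.pi * Complex.I * n ^ 2 * (τ / (2 : ℕ)))) := by
  have h1 : 0 < (τ / (14 : ℕ)).im := by
    rw [Complex.div_natCast_im]
    exact div_pos hτ (by norm_num)
  have h2 : 0 < (τ / (2 : ℕ)).im := by
    rw [Complex.div_natCast_im]
    exact div_pos hτ (by norm_num)
  have h := hasSum_mul_int (summable_twisted_linear h1 z) (summable_twisted h2 w)
  exact h

theorem summable_gaussian {τ : ℂ} (hτ : 0 < τ.im) :
    Summable fun p : ℤ × ℤ => (p.1 : ℂ) * gaussian τ p := by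
  refine (hasSum_twisted_mul hτ 0 0).summable.congr fun p => ?_
  rw [gaussian, mul_assoc, ← Complex.exp_add]
  congr 2
  push_cast
  ring

theorem summable_thetaTerm (φ : ZMod 7 → ℂ) {τ : ℂ} (hτ : 0 < τ.im) :
    Summable (thetaTerm φ τ) := by
  obtain ⟨C, hC⟩ : ∃ C : ℝ, ∀ x, ‖φ x‖ ≤ C :=
    ⟨∑ x, ‖φ x‖, fun x => Finset.single_le_sum (fun i _ => norm_nonneg (φ i)) (Finset.mem_univ x)⟩
  refine Summable.of_norm_bounded
    (((summable_gaussian hτ).comp_injective halfCoord_injective).norm.mul_left (C / 2))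
    fun z => ?_
  have h : thetaTerm φ τ z = φ (4 * (halfCoord z).1) / 2 *
      (((halfCoord z).1 : ℂ) * gaussian τ (halfCoord z)) := by
    linear_combination thetaTerm_eq φ τ z / 2
  rw [h, norm_mul, norm_div, Complex.norm_ofNat]
  exact mul_le_mul_of_nonneg_right (div_le_div_of_nonneg_right (hC _) (by norm_num))
    (norm_nonneg _)

/-- The Fourier transform on `ℤ/7` with kernel `exp (4 π i x y / 7)`. -/
def fourier7 (φ : ZMod 7 → ℂ) (y : ZMod 7) : ℂ := ∑ x, φ x * e7 (2 * x * y)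

/-- In the coordinates a = 2u + v, b = v the Gaussian factors, but the lattice is only the half a ≡
b modulo 2. Summing over s = 0, 1 with both characters shifted by s/2 inserts 1 + (-1)^(a+b), which
is twice the indicator of that half; x/7 supplies the kernel of `fourier7`. -/
theorem hasSum_theta_fourier7 {τ : ℂ} (hτ : 0 < τ.im) (φ : ZMod 7 → ℂ) :
    HasSum (fun z => 4 * thetaTerm (fourier7 φ) τ z)
      (∑ x : ZMod 7, ∑ s : Fin 2, φ x *
        ((∑' n : ℤ, (n : ℂ) * Complex.exp (2 * Real.pi * Complex.I * n *
            ((2 * x.val + 7 * s.val : ℤ) / (14 : ℕ)) +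
            Real.pi * Complex.I * n ^ 2 * (τ / (14 : ℕ)))) *
          ∑' n : ℤ, Complex.exp (2 * Real.pi * Complex.I * n * ((s.val : ℤ) / (2 : ℕ)) +
            Real.pi * Complex.I * n ^ 2 * (τ / (2 : ℕ))))) := by
  have h := hasSum_sum (s := Finset.univ) fun (x : ZMod 7) _ =>
    hasSum_sum (s := Finset.univ) fun (s : Fin 2) _ =>
      (hasSum_twisted_mul hτ ((2 * x.val + 7 * s.val : ℤ) / (14 : ℕ))
        ((s.val : ℤ) / (2 : ℕ))).mul_left (φ x)
  have key : ∀ (p : ℤ × ℤ) (x : ZMod 7), (∑ s : Fin 2, φ x *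
      ((p.1 : ℂ) * Complex.exp (2 * Real.pi * Complex.I * p.1 *
          ((2 * x.val + 7 * s.val : ℤ) / (14 : ℕ)) +
        Real.pi * Complex.I * p.1 ^ 2 * (τ / (14 : ℕ))) *
        Complex.exp (2 * Real.pi * Complex.I * p.2 * ((s.val : ℤ) / (2 : ℕ)) +
          Real.pi * Complex.I * p.2 ^ 2 * (τ / (2 : ℕ))))) =
      (1 + Complex.exp (Real.pi * Complex.I * (p.1 + p.2 : ℤ))) *
        (φ x * e7 (p.1 * x) * p.1 * gaussian τ p) := by
    intro p x
    have he : e7 (p.1 * x) = Complex.exp (2 * Real.pi * Complex.I * (p.1 * x.val : ℤ) / 7) := by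
      rw [← e7_intCast]
      push_cast
      rw [ZMod.natCast_zmod_val]
    have h0 : Complex.exp (2 * Real.pi * Complex.I * p.1 *
          ((2 * x.val + 7 * (0 : Fin 2).val : ℤ) / (14 : ℕ)) +
        Real.pi * Complex.I * p.1 ^ 2 * (τ / (14 : ℕ))) *
        Complex.exp (2 * Real.pi * Complex.I * p.2 * (((0 : Fin 2).val : ℤ) / (2 : ℕ)) +
          Real.pi * Complex.I * p.2 ^ 2 * (τ / (2 : ℕ))) = e7 (p.1 * x) * gaussian τ p := by
      rw [he, gaussian, ← Complex.exp_add, ← Complex.exp_add, Fin.val_zero]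
      congr 1
      push_cast
      ring
    have h1 : Complex.exp (2 * Real.pi * Complex.I * p.1 *
          ((2 * x.val + 7 * (1 : Fin 2).val : ℤ) / (14 : ℕ)) +
        Real.pi * Complex.I * p.1 ^ 2 * (τ / (14 : ℕ))) *
        Complex.exp (2 * Real.pi * Complex.I * p.2 * (((1 : Fin 2).val : ℤ) / (2 : ℕ)) +
          Real.pi * Complex.I * p.2 ^ 2 * (τ / (2 : ℕ))) =
        Complex.exp (Real.pi * Complex.I * (p.1 + p.2 : ℤ)) * (e7 (p.1 * x) * gaussian τ p) := by
      rw [he, gaussian, ← Complex.exp_add, ← Complex.exp_add, ← Complex.exp_add, Fin.val_one]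
      congr 1
      push_cast
      ring
    rw [Fin.sum_univ_two]
    linear_combination (φ x * p.1) * h0 + (φ x * p.1) * h1
  simp only [key] at h
  rw [← halfCoord_injective.hasSum_iff] at h
  · refine hasSum_of_eq h (fun z => ?_) rfl
    have hz : Even ((halfCoord z).1 + (halfCoord z).2) := mem_range_halfCoord.mp ⟨z, rfl⟩
    simp only [Function.comp_apply, exp_pi_int_of_even hz]
    rw [← Finset.mul_sum, ← Finset.sum_mul, ← Finset.sum_mul]
    have h4 := thetaTerm_eq (fourier7 φ) τ z
    have h5 : fourier7 φ (4 * (halfCoord z).1) = ∑ x, φ x * e7 ((halfCoord z).1 * x) := by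
      unfold fourier7
      refine Finset.sum_congr rfl fun x _ => ?_
      congr 2
      have h7 : (7 : ZMod 7) = 0 := rfl
      linear_combination (x * (halfCoord z).1 : ZMod 7) * h7
    rw [← h5]
    linear_combination 2 * h4
  · intro p hp
    rw [mem_range_halfCoord, Int.not_even_iff_odd] at hp
    rw [← Finset.mul_sum, exp_pi_int_of_odd hp, add_neg_cancel, zero_mul]

/-- Coordinates adapted to the residue classes of `2 u + v` modulo `14` and of `v` modulo `2`. -/
def residueCoord (q : (ZMod 7 × Fin 2) × (ℤ × ℤ)) : ℤ × ℤ :=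
  (q.1.1.val + 3 * q.1.2.val + 7 * q.2.1 - q.2.2, 2 * q.2.2 + q.1.2.val)

theorem residueCoord_bijective : Function.Bijective residueCoord := by
  constructor
  · rintro ⟨⟨x, s⟩, n, w⟩ ⟨⟨x', s'⟩, n', w'⟩ h
    have hx := ZMod.val_lt x
    have hx' := ZMod.val_lt x'
    have hs := s.isLt
    have hs' := s'.isLt
    simp only [residueCoord, Prod.mk.injEq] at h
    have h1 : s.val = s'.val := by omega
    have h2 : x.val = x'.val := by omega
    have h3 : w = w' := by omega
    have h4 : n = n' := by omega
    rw [ZMod.val_injective 7 h2, Fin.ext h1, h3, h4]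
  · rintro ⟨u, v⟩
    let s : Fin 2 := ⟨(v % 2).toNat, by omega⟩
    have hs : (s.val : ℤ) = v % 2 := by simp only [s]; omega
    let y : ℕ := ((u + v / 2 - 3 * s.val) % 7).toNat
    have hy : y < 7 := by omega
    have hy' : (y : ℤ) = (u + v / 2 - 3 * s.val) % 7 := by simp only [y]; omega
    refine ⟨((((y : ℕ) : ZMod 7), s), (u + v / 2 - 3 * s.val) / 7, v / 2), ?_⟩
    simp only [residueCoord, ZMod.val_natCast_of_lt hy, Prod.mk.injEq]
    omega

/-- The dual splitting: a runs over 2x + 7s modulo 14 and b over s modulo 2, which enforces a ≡ b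
modulo 2, and φ is constant on each class since 4(2x + 7s) ≡ x modulo 7. -/
theorem two_mul_theta_eq {τ : ℂ} (hτ : 0 < τ.im) (φ : ZMod 7 → ℂ) :
    2 * theta φ (-1 / τ) = ∑ x : ZMod 7, ∑ s : Fin 2, φ x *
      ((∑' n : ℤ, ((14 : ℕ) * n + (2 * x.val + 7 * s.val : ℤ) : ℂ) *
        Complex.exp (Real.pi * Complex.I * ((14 : ℕ) * n + (2 * x.val + 7 * s.val : ℤ)) ^ 2 *
          (-1 / τ) / (14 : ℕ))) *
      ∑' n : ℤ, Complex.exp (Real.pi * Complex.I * ((2 : ℕ) * n + (s.val : ℤ)) ^ 2 *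
          (-1 / τ) / (2 : ℕ))) := by
  have hs := (summable_thetaTerm φ (neg_one_div_im_pos hτ)).mul_left 2
  rw [theta, ← tsum_mul_left, ← (Equiv.ofBijective _ residueCoord_bijective).tsum_eq]
  rw [← (Equiv.ofBijective _ residueCoord_bijective).summable_iff] at hs
  simp only [Function.comp_def] at hs
  rw [Summable.tsum_prod hs, tsum_fintype, Fintype.sum_prod_type]
  refine Finset.sum_congr rfl fun x _ => Finset.sum_congr rfl fun s _ => ?_
  have s1 := (hasSum_residue_linear hτ (M := 14) (by norm_num) (2 * x.val + 7 * s.val)).summable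
  have s2 := (hasSum_residue hτ (M := 2) (by norm_num) s.val).summable
  have h := (hasSum_mul_int s1 s2).mul_left (φ x)
  rw [← h.tsum_eq]
  refine tsum_congr fun q => ?_
  simp only [Equiv.ofBijective_apply]
  rw [thetaTerm_eq]
  have hh : halfCoord (residueCoord ((x, s), q)) =
      (14 * q.1 + (2 * x.val + 7 * s.val), 2 * q.2 + s.val) := by
    simp only [halfCoord, residueCoord, Prod.mk.injEq]
    exact ⟨by ring, trivial⟩
  have hx : (4 * ((14 * q.1 + (2 * x.val + 7 * s.val) : ℤ) : ZMod 7)) = x := by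
    have h7 : (7 : ZMod 7) = 0 := rfl
    push_cast
    rw [ZMod.natCast_zmod_val]
    linear_combination (8 * q.1 + x + 4 * s.val : ZMod 7) * h7
  rw [hh]
  simp only
  rw [hx, gaussian, mul_assoc (φ x), mul_assoc (_ + _ : ℂ), ← Complex.exp_add]
  push_cast
  congr 3
  ring

/-- The two arguments differ by the positive factor 7, so their principal square roots lie on the
same ray and no sign ambiguity arises. -/
theorem cpow_half_mul {w : ℂ} (hw : w ≠ 0) :
    (w / (14 : ℕ)) ^ (1 / 2 : ℂ) * (w / (2 : ℕ)) ^ (1 / 2 : ℂ) = Real.sqrt 7 * w / 14 := by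
  have h : (w / (14 : ℕ)) ≠ 0 := div_ne_zero hw (by norm_num)
  have h2 : (w / (2 : ℕ)) ^ (1 / 2 : ℂ) = Real.sqrt 7 * (w / (14 : ℕ)) ^ (1 / 2 : ℂ) := by
    rw [show w / (2 : ℕ) = (7 : ℝ) * (w / (14 : ℕ)) by push_cast; ring,
      Complex.cpow_def_of_ne_zero (mul_ne_zero (by norm_num) h), Complex.cpow_def_of_ne_zero h,
      Complex.log_ofReal_mul (by norm_num) h, add_mul, Complex.exp_add,
      show (Real.log 7 : ℂ) * (1 / 2) = ((Real.log 7 * (1 / 2) : ℝ) : ℂ) by push_cast; ring,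
      ← Complex.ofReal_exp, ← Real.rpow_def_of_pos (by norm_num), ← Real.sqrt_eq_rpow]
  have h3 : (w / (14 : ℕ)) ^ (1 / 2 : ℂ) * (w / (14 : ℕ)) ^ (1 / 2 : ℂ) = w / (14 : ℕ) := by
    rw [← Complex.cpow_add _ _ h]
    norm_num
  rw [h2, mul_left_comm, h3]
  push_cast
  ring

/-- Poisson summation for the lattice: the two preceding decompositions match term by term under the
one-variable functional equations. -/
theorem theta_fourier7 {τ : ℂ} (hτ : 0 < τ.im) (φ : ZMod 7 → ℂ) :
    theta (fourier7 φ) τ = -gauss7 * (τ ^ 2)⁻¹ * theta φ (-1 / τ) := by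
  have hτ0 := ne_zero_of_im_pos hτ
  have h1 := (hasSum_theta_fourier7 hτ φ).tsum_eq
  rw [tsum_mul_left] at h1
  change 4 * theta (fourier7 φ) τ = _ at h1
  have h2 := two_mul_theta_eq hτ φ
  have hw : -Complex.I * τ ≠ 0 := mul_ne_zero (neg_ne_zero.mpr Complex.I_ne_zero) hτ0
  have h3 := cpow_half_mul hw
  have h4 : 2 * theta φ (-1 / τ) = -τ * (Real.sqrt 7 * (-Complex.I * τ) / 14) *
      (4 * theta (fourier7 φ) τ) := by
    rw [h2, h1, Finset.mul_sum]
    refine Finset.sum_congr rfl fun x _ => ?_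
    rw [Finset.mul_sum]
    refine Finset.sum_congr rfl fun s _ => ?_
    rw [(hasSum_residue_linear hτ (M := 14) (by norm_num) (2 * x.val + 7 * s.val)).tsum_eq,
      (hasSum_residue hτ (M := 2) (by norm_num) s.val).tsum_eq, ← h3, mul_div_assoc,
      mul_div_assoc]
    ring
  have hs : ((Real.sqrt 7 : ℝ) : ℂ) ^ 2 = 7 := by
    rw [← Complex.ofReal_pow, Real.sq_sqrt (by norm_num)]; norm_num
  rw [gauss7_eq]
  have h5 : theta φ (-1 / τ) = Complex.I * Real.sqrt 7 / 7 * τ ^ 2 * theta (fourier7 φ) τ := by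
    linear_combination h4 / 2
  rw [h5]
  field_simp
  linear_combination (theta (fourier7 φ) τ) * (Complex.I ^ 2 * hs + 7 * Complex.I_sq)

/-- The residue u + 4v is a square root of the norm modulo 7: (u + 4v)² ≡ u² + uv + 2v². -/
theorem thetaTerm_add_one (φ : ZMod 7 → ℂ) (τ : ℂ) (z : ℤ × ℤ) :
    thetaTerm φ (τ + 1) z = thetaTerm (fun x => e7 (x ^ 2) * φ x) τ z := by
  simp only [thetaTerm]
  have h : e7 (((z.1 + 4 * z.2 : ℤ) : ZMod 7) ^ 2) =
      Complex.exp (2 * Real.pi * Complex.I * normForm z / 7) := by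
    rw [← e7_intCast]
    congr 1
    have h7 : (7 : ZMod 7) = 0 := rfl
    unfold normForm
    push_cast
    linear_combination (z.1 * z.2 + 2 * z.2 ^ 2 : ZMod 7) * h7
  rw [h, show (2 * Real.pi * Complex.I * (τ + 1) * normForm z / 7 : ℂ) =
    2 * Real.pi * Complex.I * normForm z / 7 + 2 * Real.pi * Complex.I * τ * normForm z / 7 by ring,
    Complex.exp_add]
  ring

theorem theta_add_one (φ : ZMod 7 → ℂ) (τ : ℂ) :
    theta φ (τ + 1) = theta (fun x => e7 (x ^ 2) * φ x) τ :=
  tsum_congr (thetaTerm_add_one φ τ)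

section

open scoped ModularForm Manifold

/-! ### Modular behaviour of the theta series -/

theorem four_mul_normForm (z : ℤ × ℤ) :
    4 * normForm z = (2 * z.1 + z.2) ^ 2 + 7 * z.2 ^ 2 := by
  unfold normForm
  ring

theorem normForm_nonneg (z : ℤ × ℤ) : 0 ≤ normForm z := by
  nlinarith [four_mul_normForm z, sq_nonneg (2 * z.1 + z.2), sq_nonneg z.2]

theorem normForm_pos {z : ℤ × ℤ} (hz : z ≠ 0) : 0 < normForm z := by
  refine lt_of_le_of_ne (normForm_nonneg z) fun h => hz ?_
  have h4 := four_mul_normForm z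
  rw [← h] at h4
  have h2 : z.2 = 0 := by
    have : z.2 ^ 2 = 0 := by nlinarith [sq_nonneg (2 * z.1 + z.2), sq_nonneg z.2]
    exact pow_eq_zero_iff (two_ne_zero) |>.mp this
  rw [h2] at h4
  have h1 : z.1 = 0 := by
    have : z.1 ^ 2 = 0 := by nlinarith
    exact pow_eq_zero_iff (two_ne_zero) |>.mp this
  exact Prod.ext h1 h2

theorem theta_const_mul (c : ℂ) (φ : ZMod 7 → ℂ) (τ : ℂ) :
    theta (fun x => c * φ x) τ = c * theta φ τ := by
  rw [theta, theta, ← tsum_mul_left]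
  refine tsum_congr fun z => ?_
  simp only [thetaTerm]
  ring

theorem theta_comp_neg (φ : ZMod 7 → ℂ) (τ : ℂ) :
    theta (fun x => φ (-x)) τ = -theta φ τ := by
  rw [theta, theta, ← tsum_neg, ← (Equiv.neg (ℤ × ℤ)).tsum_eq]
  refine tsum_congr fun z => ?_
  simp only [thetaTerm, Equiv.neg_apply, Prod.fst_neg, Prod.snd_neg, normForm]
  rw [show (-(-z.1 + 4 * -z.2 : ℤ) : ZMod 7) = ((z.1 + 4 * z.2 : ℤ) : ZMod 7) by push_cast; ring]
  push_cast
  ring_nf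

theorem norm_thetaTerm (φ : ZMod 7 → ℂ) (τ : ℂ) (z : ℤ × ℤ) :
    ‖thetaTerm φ τ z‖ = ‖φ ((z.1 + 4 * z.2 : ℤ) : ZMod 7) * (z.1 + z.2 / 2)‖ *
      Real.exp (-(2 * Real.pi * τ.im * normForm z / 7)) := by
  rw [thetaTerm, norm_mul, Complex.norm_exp]
  congr 2
  rw [show (2 * Real.pi * Complex.I * τ * normForm z / 7 : ℂ) =
    ((2 * Real.pi * normForm z / 7 : ℝ) : ℂ) * (Complex.I * τ) by push_cast; ring,
    Complex.re_ofReal_mul, Complex.I_mul_re]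
  ring

theorem norm_thetaTerm_le (φ : ZMod 7 → ℂ) {τ σ : ℂ} (h : σ.im ≤ τ.im) (z : ℤ × ℤ) :
    ‖thetaTerm φ τ z‖ ≤ ‖thetaTerm φ σ z‖ := by
  have hn : (0 : ℝ) ≤ normForm z := by exact_mod_cast normForm_nonneg z
  rw [norm_thetaTerm, norm_thetaTerm]
  gcongr

theorem differentiableOn_theta (φ : ZMod 7 → ℂ) :
    DifferentiableOn ℂ (theta φ) {τ | 0 < τ.im} := by
  intro τ hτ
  have hτ' : 0 < τ.im := hτ
  have ht : 0 < ((τ.im / 2 : ℝ) * Complex.I).im := by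
    rw [Complex.im_ofReal_mul, Complex.I_im]
    linarith
  have hU : IsOpen {w : ℂ | τ.im / 2 < w.im} := isOpen_lt continuous_const Complex.continuous_im
  have h := Complex.differentiableOn_tsum_of_summable_norm (F := fun z w => thetaTerm φ w z)
    (summable_thetaTerm φ ht).norm (fun z => by
      unfold thetaTerm
      fun_prop) hU (fun z w hw => norm_thetaTerm_le φ (by
        rw [Complex.im_ofReal_mul, Complex.I_im, mul_one]
        exact le_of_lt hw) z)
  exact (h.differentiableAt (hU.mem_nhds (by
    change τ.im / 2 < τ.im
    linarith))).differentiableWithinAt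

/-- The theta series as a function on the upper half plane. -/
def thetaH (φ : ZMod 7 → ℂ) (τ : ℍ) : ℂ := theta φ τ

theorem mdifferentiable_thetaH (φ : ZMod 7 → ℂ) : MDiff (thetaH φ) := by
  rw [UpperHalfPlane.mdifferentiable_iff]
  refine (differentiableOn_theta φ).congr fun τ hτ => ?_
  simp only [Function.comp_apply, thetaH]
  rw [UpperHalfPlane.ofComplex_apply_of_im_pos hτ]

/-- Dominated convergence with the series at i as majorant. The only term without exponential decay
is α = 0, and it is killed by its weight Re(α) = 0. -/
theorem isZeroAtImInfty_thetaH (φ : ZMod 7 → ℂ) : IsZeroAtImInfty (thetaH φ) := by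
  have hI : 0 < Complex.I.im := by simp
  have h := tendsto_tsum_of_dominated_convergence (𝓕 := atImInfty)
    (f := fun (τ : ℍ) z => thetaTerm φ τ z) (g := fun _ => 0) (summable_thetaTerm φ hI).norm
    (fun z => ?_) ?_
  · rw [tsum_zero] at h
    exact h
  · by_cases hz : z = 0
    · subst hz
      simp [thetaTerm]
    · rw [tendsto_zero_iff_norm_tendsto_zero]
      simp only [norm_thetaTerm]
      rw [← mul_zero ‖φ ((z.1 + 4 * z.2 : ℤ) : ZMod 7) * (z.1 + z.2 / 2)‖]
      refine Filter.Tendsto.const_mul _ (Real.tendsto_exp_neg_atTop_nhds_zero.comp ?_)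
      have hpos : (0 : ℝ) < normForm z := by exact_mod_cast normForm_pos hz
      have : Filter.Tendsto (fun τ : ℍ => τ.im) atImInfty Filter.atTop := Filter.tendsto_comap
      refine (this.const_mul_atTop (r := 2 * Real.pi * normForm z / 7) (by positivity)).congr
        fun τ => ?_
      rw [UpperHalfPlane.coe_im]
      ring
  · have : ∀ᶠ τ : ℍ in atImInfty, 1 ≤ τ.im :=
      (atImInfty_mem _).mpr ⟨1, fun τ hτ => hτ⟩
    filter_upwards [this] with τ hτ z
    exact norm_thetaTerm_le φ (by simpa using hτ) z

theorem thetaH_slash_T (φ : ZMod 7 → ℂ) :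
    thetaH φ ∣[(2 : ℤ)] ModularGroup.T = thetaH (fun x => e7 (x ^ 2) * φ x) := by
  ext τ
  rw [ModularForm.SL_slash_apply, ModularGroup.denom_apply, modular_T_smul]
  simp only [thetaH, ← theta_add_one, coe_vadd, ModularGroup.T]
  simp [add_comm]

/-- The minus sign in `theta_fourier7` is absorbed by φ(x) ↦ φ(-x), since the weight Re(α) is odd.
This turns the kernel into the one of `weil_mul_S`. -/
theorem thetaH_slash_S (φ : ZMod 7 → ℂ) : thetaH φ ∣[(2 : ℤ)] ModularGroup.S =
    thetaH (fun y => gauss7⁻¹ * ∑ x, e7 (-2 * x * y) * φ x) := by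
  ext τ
  have h1 : (fun y => gauss7⁻¹ * ∑ x, e7 (-2 * x * y) * φ x) =
      fun y => gauss7⁻¹ * (fun y => fourier7 φ (-y)) y := by
    ext y
    simp only [fourier7]
    congr 1
    refine Finset.sum_congr rfl fun x _ => ?_
    rw [mul_comm (φ x), show -2 * x * y = 2 * x * -y by ring]
  rw [ModularForm.SL_slash_apply, ModularGroup.denom_apply, modular_S_smul]
  simp only [thetaH]
  rw [h1, theta_const_mul, theta_comp_neg, theta_fourier7 τ.im_pos]
  have hg := gauss7_ne_zero
  have hS : (((ModularGroup.S 1 0 : ℤ) : ℂ) * τ + ((ModularGroup.S 1 1 : ℤ) : ℂ)) = τ := by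
    simp [ModularGroup.S]
  rw [hS, show (-1 / τ : ℂ) = (-τ : ℂ)⁻¹ by rw [← neg_inv]; ring, zpow_neg]
  field_simp

/-- The Weil representation of an integral matrix. -/
def weilSL (γ : SL(2, ℤ)) (φ : ZMod 7 → ℂ) : ZMod 7 → ℂ :=
  weil (γ 0 0 : ZMod 7) (γ 0 1 : ZMod 7) (γ 1 0 : ZMod 7) (γ 1 1 : ZMod 7) φ

theorem det_cast (γ : SL(2, ℤ)) :
    (γ 0 0 : ZMod 7) * (γ 1 1 : ZMod 7) - (γ 0 1 : ZMod 7) * (γ 1 0 : ZMod 7) = 1 := by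
  have h := γ.det_coe
  rw [Matrix.det_fin_two] at h
  exact_mod_cast congrArg (Int.cast : ℤ → ZMod 7) h

theorem weilSL_one (φ : ZMod 7 → ℂ) : weilSL 1 φ = φ := by
  ext x
  simp [weilSL, weil]

theorem weilSL_mul_T (γ : SL(2, ℤ)) (φ : ZMod 7 → ℂ) :
    weilSL (γ * ModularGroup.T) φ = fun x => e7 (x ^ 2) * weilSL γ φ x := by
  ext x
  rw [weilSL, weilSL, ← weil_mul_T (det_cast γ)]
  congr 1 <;> simp [ModularGroup.coe_T, Matrix.SpecialLinearGroup.coe_mul, Matrix.mul_apply,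
    Fin.sum_univ_two]

theorem weilSL_mul_S (γ : SL(2, ℤ)) (φ : ZMod 7 → ℂ) :
    weilSL (γ * ModularGroup.S) φ =
      fun y => gauss7⁻¹ * ∑ x, e7 (-2 * x * y) * weilSL γ φ x := by
  ext x
  rw [weilSL, weilSL, ← weil_mul_S (det_cast γ)]
  congr 1 <;> simp [ModularGroup.coe_S, Matrix.SpecialLinearGroup.coe_mul, Matrix.mul_apply,
    Fin.sum_univ_two]

theorem thetaH_slash (γ : SL(2, ℤ)) (φ : ZMod 7 → ℂ) :
    thetaH φ ∣[(2 : ℤ)] γ = thetaH (weilSL γ φ) := by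
  have gen : ∀ g ∈ ({ModularGroup.S, ModularGroup.T} : Set SL(2, ℤ)), ∀ γ : SL(2, ℤ),
      thetaH (weilSL γ φ) ∣[(2 : ℤ)] g = thetaH (weilSL (γ * g) φ) := by
    rintro g (rfl | rfl) γ
    · rw [thetaH_slash_S, weilSL_mul_S]
    · rw [thetaH_slash_T, weilSL_mul_T]
  have hγ : γ ∈ Subgroup.closure ({ModularGroup.S, ModularGroup.T} : Set SL(2, ℤ)) := by
    rw [SpecialLinearGroup.SL2Z_generators]
    trivial
  induction hγ using Subgroup.closure_induction_right with
  | one => rw [SlashAction.slash_one, weilSL_one]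
  | mul_right x _ g hg ih => rw [SlashAction.slash_mul, ih, gen g hg]
  | mul_inv_cancel x _ g hg ih =>
    have h := gen g hg (x * g⁻¹)
    rw [inv_mul_cancel_right] at h
    rw [SlashAction.slash_mul, ih, ← h, ← SlashAction.slash_mul, mul_inv_cancel,
      SlashAction.slash_one]

end

section

open scoped ModularForm Manifold Pointwise

/-- The matrix of determinant one with the given entries. -/
def mkSL {R : Type*} [CommRing R] (a b c d : R) (h : a * d - b * c = 1) :
    Matrix.SpecialLinearGroup (Fin 2) R :=
  ⟨!![a, b; c, d], by rw [Matrix.det_fin_two_of]; exact h⟩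

section mkSL

variable {R : Type*} [CommRing R] (a b c d : R) (h : a * d - b * c = 1)

@[simp] theorem mkSL_zero_zero : mkSL a b c d h 0 0 = a := rfl
@[simp] theorem mkSL_zero_one : mkSL a b c d h 0 1 = b := rfl
@[simp] theorem mkSL_one_zero : mkSL a b c d h 1 0 = c := rfl
@[simp] theorem mkSL_one_one : mkSL a b c d h 1 1 = d := rfl

end mkSL

/-! ### The subgroup of matrices that are diagonal modulo `7` -/

/-- The diagonal subgroup of `SL₂(ℤ/7)`. -/
def diag7 : Subgroup (Matrix.SpecialLinearGroup (Fin 2) (ZMod 7)) where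
  carrier := {g | g 0 1 = 0 ∧ g 1 0 = 0}
  one_mem' := by simp
  mul_mem' := by
    rintro a b ⟨h1, h2⟩ ⟨h3, h4⟩
    simp [Matrix.SpecialLinearGroup.coe_mul, Matrix.mul_apply, Fin.sum_univ_two, h1, h2, h3, h4]
  inv_mem' := by
    rintro a ⟨h1, h2⟩
    simp [Matrix.SpecialLinearGroup.coe_inv, Matrix.adjugate_fin_two, h1, h2]

theorem mem_diag7 {g : Matrix.SpecialLinearGroup (Fin 2) (ZMod 7)} :
    g ∈ diag7 ↔ g 0 1 = 0 ∧ g 1 0 = 0 := Iff.rfl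

/-- The subgroup of matrices in `SL₂(ℤ)` that are diagonal modulo `7`. -/
def D7 : Subgroup SL(2, ℤ) :=
  diag7.comap (Matrix.SpecialLinearGroup.map (Int.castRingHom (ZMod 7)))

theorem mem_D7 {γ : SL(2, ℤ)} :
    γ ∈ D7 ↔ (γ 0 1 : ZMod 7) = 0 ∧ (γ 1 0 : ZMod 7) = 0 := Iff.rfl

/-! ### The index of the diagonal group -/

theorem reduction_mod_seven_surjective : Function.Surjective
    (Matrix.SpecialLinearGroup.map (n := Fin 2) (Int.castRingHom (ZMod 7))) := by
  set π := Matrix.SpecialLinearGroup.map (n := Fin 2) (Int.castRingHom (ZMod 7)) with hπ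
  let U : ℤ → SL(2, ℤ) := fun x => mkSL 1 x 0 1 (by ring)
  let L : ℤ → SL(2, ℤ) := fun x => mkSL 1 0 x 1 (by ring)
  have key : ∀ g : Matrix.SpecialLinearGroup (Fin 2) (ZMod 7), g 1 0 ≠ 0 → ∃ γ, π γ = g := by
    intro g hc
    have hdet := g.det_coe
    rw [Matrix.det_fin_two] at hdet
    -- A matrix with invertible lower left entry c is upper · lower · upper unipotent, the middle
    -- factor carrying c; unipotents lift to ℤ.
    refine ⟨U ((g 0 0 - 1) / g 1 0 : ZMod 7).val * L (g 1 0).val *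
      U ((g 1 1 - 1) / g 1 0 : ZMod 7).val, ?_⟩
    ext i j
    fin_cases i <;> fin_cases j <;>
      simp [hπ, U, L, Matrix.SpecialLinearGroup.coe_mul, Matrix.mul_apply, Fin.sum_univ_two] <;>
      field_simp <;> first | ring1 | linear_combination hdet
  intro g
  by_cases hc : g 1 0 = 0
  · obtain ⟨γ, hγ⟩ := key (π (L 1) * g) (by
      have hdet := g.det_coe
      rw [Matrix.det_fin_two, hc] at hdet
      have ha : g 0 0 ≠ 0 := by
        intro h
        rw [h] at hdet
        simp at hdet
      simpa [hπ, L, Matrix.SpecialLinearGroup.coe_mul, Matrix.mul_apply, Fin.sum_univ_two, hc]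
        using ha)
    exact ⟨(L 1)⁻¹ * γ, by rw [map_mul, hγ, map_inv, inv_mul_cancel_left]⟩
  · exact key g hc

theorem card_SL_two_zmod_seven :
    Nat.card (Matrix.SpecialLinearGroup (Fin 2) (ZMod 7)) = 336 := by
  let e : Matrix.SpecialLinearGroup (Fin 2) (ZMod 7) ≃
      {p : (ZMod 7 × ZMod 7) × (ZMod 7 × ZMod 7) // p.1.1 * p.2.2 - p.1.2 * p.2.1 = 1} :=
    { toFun := fun g => ⟨((g 0 0, g 0 1), (g 1 0, g 1 1)), by
        rw [← Matrix.det_fin_two]; exact g.det_coe⟩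
      invFun := fun p => mkSL p.1.1.1 p.1.1.2 p.1.2.1 p.1.2.2 p.2
      left_inv := fun g => by
        ext i j; fin_cases i <;> fin_cases j <;> rfl
      right_inv := fun p => rfl }
  rw [Nat.card_congr e, Nat.card_eq_fintype_card]
  decide +kernel

theorem card_diag7 : Nat.card diag7 = 6 := by
  let e : diag7 ≃ {p : ZMod 7 × ZMod 7 // p.1 * p.2 = 1} :=
    { toFun := fun g => ⟨(g.1 0 0, g.1 1 1), by
        have h := g.1.det_coe
        rw [Matrix.det_fin_two, g.2.1] at h
        linear_combination h⟩
      invFun := fun p => ⟨mkSL p.1.1 0 0 p.1.2 (by linear_combination p.2), by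
        simp [mem_diag7]⟩
      left_inv := fun g => by
        have h1 := g.2.1
        have h2 := g.2.2
        ext i j
        fin_cases i <;> fin_cases j <;> simp [h1, h2]
      right_inv := fun p => rfl }
  rw [Nat.card_congr e, Nat.card_eq_fintype_card]
  decide +kernel

theorem index_D7 : D7.index = 56 := by
  rw [D7, Subgroup.index_comap_of_surjective _ reduction_mod_seven_surjective]
  have h := diag7.card_mul_index
  rw [card_diag7, card_SL_two_zmod_seven] at h
  omega

instance : D7.FiniteIndex := ⟨by rw [index_D7]; norm_num⟩

/-! ### The theta series as a cusp form on Γ₀(49) -/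

/-- The group `D7` viewed inside `GL₂(ℝ)`. -/
abbrev GD7 : Subgroup (GL (Fin 2) ℝ) := D7.map (Matrix.SpecialLinearGroup.mapGL ℝ)

theorem mem_GD7 {γ : SL(2, ℤ)} (h : γ ∈ D7) : Matrix.SpecialLinearGroup.mapGL ℝ γ ∈ GD7 :=
  ⟨γ, h, rfl⟩

/-- Restriction of a cusp form to a subgroup. -/
def restrictCusp {Γ Γ' : Subgroup (GL (Fin 2) ℝ)} {k : ℤ} (h : Γ' ≤ Γ) (f : CuspForm Γ k) :
    CuspForm Γ' k where
  toFun := f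
  slash_action_eq' γ hγ := f.slash_action_eq' γ (h hγ)
  holo' := f.holo'
  zero_at_cusps' hc := f.zero_at_cusps' (hc.mono h)

theorem restrictCusp_coe {Γ Γ' : Subgroup (GL (Fin 2) ℝ)} {k : ℤ} (h : Γ' ≤ Γ)
    (f : CuspForm Γ k) : (restrictCusp h f : ℍ → ℂ) = f := rfl

/-- The theta series attached to `chi7`, as a cusp form of weight `2` on `GD7`. -/
def thetaForm : CuspForm GD7 2 where
  toFun := thetaH chi7
  slash_action_eq' := by
    rintro _ ⟨γ, hγ, rfl⟩
    obtain ⟨hb, hc⟩ := mem_D7.mp hγ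
    change thetaH chi7 ∣[(2 : ℤ)] γ = thetaH chi7
    rw [thetaH_slash]
    congr 1
    ext x
    have hdet := det_cast γ
    have hd : (γ 1 1 : ZMod 7) ≠ 0 := by
      intro h
      rw [h, hc] at hdet
      simp at hdet
    -- A diagonal matrix sends `chi7` to x ↦ χ(d)χ(dx) = χ(d)²χ(x).
    rw [weilSL, weil, if_pos hc, hb, zero_mul, zero_mul, AddChar.map_zero_eq_one, map_mul,
      mul_one, ← mul_assoc, chi7_sq hd, one_mul]
  holo' := mdifferentiable_thetaH _
  zero_at_cusps' {c} hc := by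
    rw [Subgroup.IsArithmetic.isCusp_iff_isCusp_SL2Z] at hc
    rw [OnePoint.isZeroAt_iff_forall_SL2Z hc]
    intro γ _
    change IsZeroAtImInfty (thetaH chi7 ∣[(2 : ℤ)] γ)
    rw [thetaH_slash]
    exact isZeroAtImInfty_thetaH _

/-- The matrix `diag(7, 1)`. -/
def delta7 : GL (Fin 2) ℝ :=
  Matrix.GeneralLinearGroup.mkOfDetNeZero !![7, 0; 0, 1] (by simp)

theorem exists_mem_D7_conj {γ : SL(2, ℤ)} (h : γ ∈ CongruenceSubgroup.Gamma0 49) :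
    ∃ γ' ∈ D7, Matrix.SpecialLinearGroup.mapGL ℝ γ' * delta7 =
      delta7 * Matrix.SpecialLinearGroup.mapGL ℝ γ := by
  rw [CongruenceSubgroup.Gamma0_mem, ZMod.intCast_zmod_eq_zero_iff_dvd] at h
  obtain ⟨c, hc⟩ := h
  have hdet := γ.det_coe
  rw [Matrix.det_fin_two, hc] at hdet
  push_cast at hdet
  refine ⟨mkSL (γ 0 0) (7 * γ 0 1) (7 * c) (γ 1 1) (by linear_combination hdet), ?_, ?_⟩
  · rw [mem_D7]
    have h7 : (7 : ZMod 7) = 0 := rfl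
    simp [h7]
  · ext i j
    fin_cases i <;> fin_cases j <;>
      simp [delta7, Matrix.mul_apply, Fin.sum_univ_two, hc] <;> ring

theorem exists_mem_Gamma0_conj {γ : SL(2, ℤ)} (h : γ ∈ D7) :
    ∃ γ' ∈ CongruenceSubgroup.Gamma0 49, delta7 * Matrix.SpecialLinearGroup.mapGL ℝ γ' =
      Matrix.SpecialLinearGroup.mapGL ℝ γ * delta7 := by
  obtain ⟨hb, hc⟩ := mem_D7.mp h
  rw [ZMod.intCast_zmod_eq_zero_iff_dvd] at hb hc
  obtain ⟨b, hb⟩ := hb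
  obtain ⟨c, hc⟩ := hc
  have hdet := γ.det_coe
  rw [Matrix.det_fin_two, hb, hc] at hdet
  push_cast at hdet
  refine ⟨mkSL (γ 0 0) b (49 * c) (γ 1 1) (by linear_combination hdet), ?_, ?_⟩
  · rw [CongruenceSubgroup.Gamma0_mem]
    have h49 : (49 : ZMod 49) = 0 := rfl
    simp [h49]
  · ext i j
    fin_cases i <;> fin_cases j <;>
      simp [delta7, Matrix.mul_apply, Fin.sum_univ_two, hb, hc] <;> ring

theorem G0_le_conj : G0 49 ≤ ConjAct.toConjAct delta7⁻¹ • GD7 := by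
  rintro _ ⟨γ, hγ, rfl⟩
  obtain ⟨γ', h1, h2⟩ := exists_mem_D7_conj hγ
  rw [Subgroup.mem_pointwise_smul_iff_inv_smul_mem, ← map_inv, inv_inv, ConjAct.smul_def,
    ConjAct.ofConjAct_toConjAct]
  change delta7 * Matrix.SpecialLinearGroup.mapGL ℝ γ * delta7⁻¹ ∈ _
  rw [← h2, mul_inv_cancel_right]
  exact mem_GD7 h1

theorem GD7_le_conj : GD7 ≤ ConjAct.toConjAct (delta7⁻¹)⁻¹ • G0 49 := by
  rintro _ ⟨γ, hγ, rfl⟩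
  obtain ⟨γ', h1, h2⟩ := exists_mem_Gamma0_conj hγ
  rw [Subgroup.mem_pointwise_smul_iff_inv_smul_mem, ← map_inv, inv_inv, ConjAct.smul_def,
    ConjAct.ofConjAct_toConjAct]
  change delta7⁻¹ * Matrix.SpecialLinearGroup.mapGL ℝ γ * (delta7⁻¹)⁻¹ ∈ _
  rw [inv_inv, mul_assoc, ← h2, inv_mul_cancel_left]
  exact ⟨γ', h1, rfl⟩

/-- The cusp form `½ ∑ χ(α) Re(α) q^N(α)` on `Γ₀(49)`. -/
def formG : CuspForm (G0 49) 2 :=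
  -- The weight 2 slash by diag(7, 1) produces a factor 7, so 1/14 leaves ½, which compensates for
  -- the equal contributions of α and -α.
  (1 / 14 : ℂ) • restrictCusp G0_le_conj (CuspForm.translate thetaForm delta7)

theorem slash_delta7 (f : ℍ → ℂ) (τ : ℍ) : (f ∣[(2 : ℤ)] delta7) τ = 7 * f (mulPt 7 τ) := by
  have h1 : (0 : ℝ) < delta7.det.val := by
    simp [delta7]
  have h2 : delta7 • τ = mulPt 7 τ := by
    ext
    rw [UpperHalfPlane.coe_smul_of_det_pos h1]
    simp [delta7, num, denom, mulPt]
  rw [ModularForm.slash_apply, h2]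
  simp [delta7, σ, denom]
  ring

theorem formG_apply (τ : ℍ) : formG τ = 1 / 2 * theta chi7 (7 * τ) := by
  have h : formG τ = (1 / 14 : ℂ) * ((thetaH chi7) ∣[(2 : ℤ)] delta7) τ := rfl
  rw [h, slash_delta7, thetaH]
  simp only [mulPt]
  push_cast
  ring

end

section

open scoped ModularForm Manifold Pointwise Topology
open Filter Asymptotics ModularForm

/-! ### Level one -/

/-- Each factor exp(-2π Im τ) of decay allows one division by Δ, because Δ has no zeros and decays
no faster than that at ∞; the quotient remains a modular form of level one. -/
theorem exists_discriminant_pow_mul (N : ℕ) {k : ℤ} (F : ModularForm 𝒮ℒ k)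
    (hF : F =O[atImInfty] fun τ : ℍ => Real.exp (-2 * Real.pi * N * τ.im)) :
    ∃ h : ModularForm 𝒮ℒ (k - 12 * N), ∀ τ, F τ = discriminant τ ^ N * h τ := by
  induction N with
  | zero => exact ⟨ModularForm.mcast (by simp) F rfl, fun τ => by simp⟩
  | succ N ih =>
    have hle : (fun τ : ℍ => Real.exp (-2 * Real.pi * (N + 1 : ℕ) * τ.im)) =O[atImInfty]
        fun τ : ℍ => Real.exp (-2 * Real.pi * N * τ.im) := by
      refine IsBigO.of_bound 1 (Eventually.of_forall fun τ => ?_)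
      rw [Real.norm_eq_abs, Real.norm_eq_abs, Real.abs_exp, Real.abs_exp, one_mul,
        Real.exp_le_exp]
      have := mul_pos Real.pi_pos τ.im_pos
      push_cast
      nlinarith
    obtain ⟨h, hh⟩ := ih (hF.trans hle)
    have hpow : (fun τ : ℍ => Real.exp (-2 * Real.pi * N * τ.im)) =O[atImInfty]
        fun τ => discriminant τ ^ N := by
      refine (exp_isBigO_discriminant.pow N).congr_left fun τ => ?_
      rw [← Real.exp_nat_mul]
      ring_nf
    have hbig : h =O[atImInfty] fun τ : ℍ => Real.exp (-2 * Real.pi * τ.im) := by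
      have h1 : (fun τ => discriminant τ ^ N * h τ) =O[atImInfty]
          fun τ => discriminant τ ^ N * (Real.exp (-2 * Real.pi * τ.im) : ℂ) := by
        refine ((hF.congr_left hh).trans ?_)
        refine (hpow.mul (isBigO_refl (fun τ : ℍ => (Real.exp (-2 * Real.pi * τ.im) : ℂ))
          atImInfty).norm_left).congr_left fun τ => ?_
        rw [Complex.norm_real, Real.norm_eq_abs, Real.abs_exp, ← Real.exp_add]
        push_cast
        ring_nf
      rw [← isBigO_norm_right]
      have h2 := (isBigO_refl (fun τ => (discriminant τ ^ N)⁻¹) atImInfty).mul h1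
      refine (h2.norm_right.congr (fun τ => ?_) (fun τ => ?_))
      · exact inv_mul_cancel_left₀ (pow_ne_zero _ (discriminant_ne_zero τ)) _
      · rw [inv_mul_cancel_left₀ (pow_ne_zero _ (discriminant_ne_zero τ)), Complex.norm_real]
    have hzero : IsZeroAtImInfty h := by
      refine hbig.trans_tendsto ?_
      have : Tendsto (fun τ : ℍ => ‖Function.Periodic.qParam 1 τ‖) atImInfty (𝓝 ‖(0 : ℂ)‖) :=
        (qParam_tendsto_atImInfty zero_lt_one).norm
      rw [norm_zero] at this
      refine this.congr fun τ => ?_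
      simp [Function.Periodic.qParam, Complex.norm_exp]
    have hcoeff : (qExpansion 1 h).coeff 0 = 0 := by
      rw [qExpansion_coeff_zero one_pos
        (ModularFormClass.analyticAt_cuspFunction_zero h one_pos one_mem_strictPeriods_SL)
        (SlashInvariantFormClass.periodic_comp_ofComplex h one_mem_strictPeriods_SL)]
      exact hzero.valueAtInfty_eq_zero
    refine ⟨ModularForm.mcast (by push_cast; ring)
      (CuspForm.discriminantEquiv (toCuspForm h hcoeff)) rfl, fun τ => ?_⟩
    have h3 := discriminant_mul_discriminantEquiv_apply (toCuspForm h hcoeff) τ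
    rw [toCuspForm_apply] at h3
    change _ = _ * (CuspForm.discriminantEquiv (toCuspForm h hcoeff)) τ
    rw [hh, ← h3]
    ring

/-! ### Simplicity of the zeros of E₄ -/

theorem eq_smul_E₄ (h : ModularForm 𝒮ℒ 4) : ∃ c : ℂ, c • E₄ = h :=
  (finrank_eq_one_iff_of_nonzero' E₄ (EisensteinSeries.E_ne_zero _ ⟨2, rfl⟩)).mp
    (Module.finrank_eq_of_rank_eq (by simpa using levelOne_weight_four_rank_one)) h

theorem eq_smul_E₆ (h : ModularForm 𝒮ℒ 6) : ∃ c : ℂ, c • E₆ = h :=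
  (finrank_eq_one_iff_of_nonzero' E₆ (EisensteinSeries.E_ne_zero _ ⟨3, rfl⟩)).mp
    (Module.finrank_eq_of_rank_eq (by simpa using levelOne_weight_six_rank_one)) h

-- The normalised derivative is q d/dq, and the q-series is analytic at q = 0.
open Derivative in
theorem tendsto_normalizedDeriv {k : ℤ} (F : ModularForm 𝒮ℒ k) :
    Tendsto (normalizedDerivOfComplex F) atImInfty (𝓝 0) := by
  have hper := SlashInvariantFormClass.periodic_comp_ofComplex F one_mem_strictPeriods_SL
  have key : ∀ τ : ℍ, normalizedDerivOfComplex F τ =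
      deriv (cuspFunction 1 F) (Function.Periodic.qParam 1 τ) * Function.Periodic.qParam 1 τ := by
    intro τ
    have h1 : (F ∘ ofComplex) = cuspFunction 1 F ∘ Function.Periodic.qParam 1 := by
      ext w
      exact (Function.Periodic.eq_cuspFunction one_ne_zero hper w).symm
    have hq : HasDerivAt (Function.Periodic.qParam 1)
        (2 * Real.pi * Complex.I * Function.Periodic.qParam 1 τ) (τ : ℂ) := by
      have h2 : HasDerivAt (fun w : ℂ => Complex.exp (2 * Real.pi * Complex.I * w / (1 : ℝ)))
          (Complex.exp (2 * Real.pi * Complex.I * τ / (1 : ℝ)) *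
            (2 * Real.pi * Complex.I * 1 / (1 : ℝ))) (τ : ℂ) :=
        (((hasDerivAt_id (τ : ℂ)).const_mul (2 * Real.pi * Complex.I)).div_const _).cexp
      convert! h2 using 1
      simp only [Function.Periodic.qParam, Complex.ofReal_one]
      ring
    have hd := ModularFormClass.differentiableAt_cuspFunction F one_pos one_mem_strictPeriods_SL
      (Function.Periodic.norm_qParam_lt_one one_pos τ.im_pos)
    rw [normalizedDerivOfComplex, h1, (hd.hasDerivAt.comp (τ : ℂ) hq).deriv]
    have : (2 * Real.pi * Complex.I : ℂ) ≠ 0 := Complex.two_pi_I_ne_zero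
    field_simp
  have hq := qParam_tendsto_atImInfty (h := 1) zero_lt_one
  have hc : ContinuousAt (deriv (cuspFunction 1 F)) 0 :=
    (ModularFormClass.analyticAt_cuspFunction_zero F one_pos
      one_mem_strictPeriods_SL).deriv.continuousAt
  have := (hc.tendsto.comp hq).mul hq
  rw [mul_zero] at this
  exact this.congr fun τ => (key τ).symm

theorem tendsto_of_hasSum_qExpansion {f : ℍ → ℂ} {c : ℕ → ℂ}
    (hf : ∀ τ : ℍ, HasSum (fun m => c m • Function.Periodic.qParam 1 τ ^ m) (f τ)) :
    Tendsto f atImInfty (𝓝 (c 0)) := by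
  have hg : ∀ τ : ℍ, HasSum (fun m => c (m + 1) • Function.Periodic.qParam 1 τ ^ m)
      ((f τ - c 0) / Function.Periodic.qParam 1 τ) := by
    intro τ
    have h1 := (hasSum_nat_add_iff' 1).mpr (hf τ)
    have h2 := h1.div_const (Function.Periodic.qParam 1 τ)
    simp only [Finset.sum_range_one, pow_zero, smul_eq_mul, mul_one] at h2
    have h3 : (fun m => c (m + 1) • Function.Periodic.qParam 1 (τ : ℂ) ^ m) = fun m =>
        c (m + 1) * Function.Periodic.qParam 1 (τ : ℂ) ^ (m + 1) /
          Function.Periodic.qParam 1 (τ : ℂ) := by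
      ext m
      rw [smul_eq_mul, pow_succ, ← mul_assoc,
        mul_div_cancel_right₀ _ (Function.Periodic.qParam_ne_zero _)]
    rw [h3]
    exact h2
  have hb := isBoundedAtImInfty_of_hasSum_qExpansion one_pos hg
  have hq := qParam_tendsto_atImInfty (h := 1) zero_lt_one
  have h3 := IsBigO.mul hb
    (isBigO_refl (fun τ : ℍ => Function.Periodic.qParam 1 τ) atImInfty).norm_right
  have h4 : Tendsto (fun τ => f τ - c 0) atImInfty (𝓝 0) := by
    refine (h3.congr_left fun τ => ?_).trans_tendsto (by simpa using hq.norm)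
    exact div_mul_cancel₀ _ (Function.Periodic.qParam_ne_zero _)
  simpa using h4.add_const (c 0)

theorem tendsto_E2 : Tendsto EisensteinSeries.E2 atImInfty (𝓝 1) := by
  have h := tendsto_of_hasSum_qExpansion (f := EisensteinSeries.E2) fun τ => by
    simpa only [Function.Periodic.qParam, Complex.ofReal_one, div_one] using
      EisensteinSeries.hasSum_qExpansion_E2 (z := τ)
  simpa using h

theorem tendsto_E₄ : Tendsto E₄ atImInfty (𝓝 1) := by
  have h := tendsto_of_hasSum_qExpansion (f := E₄)
    (hasSum_qExpansion one_pos
      (SlashInvariantFormClass.periodic_comp_ofComplex E₄ one_mem_strictPeriods_SL) E₄.holo'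
      (ModularFormClass.bdd_at_infty E₄))
  rwa [EisensteinSeries.E_qExpansion_coeff_zero _ ⟨2, rfl⟩] at h

open Derivative in
theorem tendsto_serreDerivative_E₄ :
    Tendsto (serreDerivative 4 E₄) atImInfty (𝓝 (-1 / 3)) := by
  have h := (tendsto_normalizedDeriv E₄).sub ((tendsto_E2.const_mul (4 * 12⁻¹)).mul tendsto_E₄)
  -- The derivative tends to 0, and E₂ and E₄ to 1, so only -4/12 remains.
  have e : (-1 / 3 : ℂ) = 0 - 4 * 12⁻¹ * 1 * 1 := by norm_num
  rw [e]
  exact h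

open Derivative in
/-- The Serre derivative of `E₄`, as a modular form. -/
def serreE₄ : ModularForm 𝒮ℒ 6 where
  toFun := serreDerivative 4 E₄
  slash_action_eq' := by
    rintro _ ⟨γ, rfl⟩
    exact serreDerivative_slash_invariant (k := 4) E₄.holo'
      (E₄.slash_action_eq' _ ⟨γ, rfl⟩)
  holo' := serreDerivative_mdifferentiable _ E₄.holo'
  bdd_at_cusps' {c} hc := by
    rw [Subgroup.IsArithmetic.isCusp_iff_isCusp_SL2Z] at hc
    rw [OnePoint.isBoundedAt_iff_forall_SL2Z hc]
    intro γ _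
    have h : serreDerivative 4 E₄ ∣[(6 : ℤ)] γ = serreDerivative 4 E₄ :=
      serreDerivative_slash_invariant (k := 4) E₄.holo' (E₄.slash_action_eq' _ ⟨γ, rfl⟩)
    rw [h]
    exact tendsto_serreDerivative_E₄.isBigO_one ℝ

-- The Serre derivative of E₄ has weight 6, hence is a multiple of E₆, nonzero by its limit at ∞. At
-- a double zero of E₄ it would vanish, so E₄ and E₆ would vanish together, and Δ with them.
open Derivative in
theorem E₄_simple_zeros {τ : ℍ} (h0 : E₄ τ = 0) : normalizedDerivOfComplex E₄ τ ≠ 0 := by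
  intro h1
  obtain ⟨c, hc⟩ := eq_smul_E₆ serreE₄
  have hfun : ∀ z, c * E₆ z = serreDerivative 4 E₄ z := fun z => DFunLike.congr_fun hc z
  have hc0 : c ≠ 0 := by
    rintro rfl
    have h := tendsto_serreDerivative_E₄.congr fun z => (hfun z).symm
    simp only [zero_mul] at h
    have := tendsto_nhds_unique h tendsto_const_nhds
    norm_num at this
  have h2 := hfun τ
  rw [serreDerivative_apply, h0, h1, mul_zero, sub_zero] at h2
  have h6 : E₆ τ = 0 := (mul_eq_zero.mp h2).resolve_left hc0
  apply discriminant_ne_zero τ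
  rw [discriminant_eq_E₄_cube_sub_E₆_sq, h0, h6]
  norm_num

-- Nine powers of Δ leave weight 112 - 108 = 4, so F = c Δ⁹E₄, which for c ≠ 0 has only simple
-- zeros.
open Derivative in
theorem eq_zero_of_weight_112 (F : ModularForm 𝒮ℒ 112) {τ : ℍ}
    (hF : F =O[atImInfty] fun τ : ℍ => Real.exp (-18 * Real.pi * τ.im))
    (h0 : F τ = 0) (h1 : normalizedDerivOfComplex F τ = 0) : F = 0 := by
  obtain ⟨h, hh⟩ := exists_discriminant_pow_mul 9 F (by
    convert hF using 4
    push_cast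
    ring)
  obtain ⟨c, hc⟩ := eq_smul_E₄ (ModularForm.mcast (by norm_num) h rfl)
  have hfun : ∀ z, F z = c * (discriminant z ^ 9 * E₄ z) := fun z => by
    have h2 : c * E₄ z = h z := DFunLike.congr_fun hc z
    rw [hh, ← h2]
    ring
  by_cases hc0 : c = 0
  · ext z
    rw [hfun, hc0, zero_mul]
    rfl
  exfalso
  have hΔ := CuspForm.discriminant.holo'
  have hE4 : MDiff E₄ := E₄.holo'
  have hΔ9 : MDiff (discriminant ^ 9) := by
    have : MDiff (fun z : ℍ => discriminant z ^ 9) := MDifferentiable.pow hΔ 9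
    exact this
  have hE0 : E₄ τ = 0 := by
    rw [hfun] at h0
    simpa [hc0, discriminant_ne_zero] using h0
  have hF' : (F : ℍ → ℂ) = c • (discriminant ^ 9 * E₄) := funext hfun
  rw [hF', normalizedDerivOfComplex_smul _ _ (hΔ9.mul hE4),
    normalizedDerivOfComplex_mul _ _ hΔ9 hE4] at h1
  simp only [Pi.smul_apply, Pi.add_apply, Pi.mul_apply, hE0, mul_zero, zero_add, Pi.pow_apply,
    smul_eq_mul, mul_eq_zero, hc0, false_or] at h1
  exact h1.elim (pow_ne_zero _ (discriminant_ne_zero τ)) (E₄_simple_zeros hE0)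

end

section

open scoped ModularForm Manifold Pointwise Topology
open Filter Asymptotics ModularForm

/-! ### Vanishing of cusp forms on `GD7` -/

/-- The class of `γ` in the quotient of `SL₂(ℤ)` by `D7`, taken inside `GL₂(ℝ)`. -/
def cosetD7 (γ : SL(2, ℤ)) : 𝒮ℒ ⧸ GD7.subgroupOf 𝒮ℒ :=
  QuotientGroup.mk ⟨Matrix.SpecialLinearGroup.mapGL ℝ γ, ⟨γ, rfl⟩⟩

theorem cosetD7_surjective : Function.Surjective cosetD7 := by
  intro q
  induction q using Quotient.inductionOn with
  | h g =>
    obtain ⟨_, γ, rfl⟩ := g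
    exact ⟨γ, rfl⟩

theorem mapGL_mem_GD7 {γ : SL(2, ℤ)} : Matrix.SpecialLinearGroup.mapGL ℝ γ ∈ GD7 ↔ γ ∈ D7 :=
  Subgroup.mem_map_iff_mem Matrix.SpecialLinearGroup.mapGL_injective

theorem cosetD7_eq_iff {γ γ' : SL(2, ℤ)} : cosetD7 γ = cosetD7 γ' ↔ γ⁻¹ * γ' ∈ D7 := by
  rw [cosetD7, cosetD7, QuotientGroup.eq, Subgroup.mem_subgroupOf, ← mapGL_mem_GD7, map_mul,
    map_inv]
  rfl

theorem quotientFunc_cosetD7 (f : CuspForm GD7 2) (γ : SL(2, ℤ)) :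
    SlashInvariantForm.quotientFunc f (cosetD7 γ) = (f : ℍ → ℂ) ∣[(2 : ℤ)] γ⁻¹ := by
  rw [ModularForm.SL_slash]
  change (f : ℍ → ℂ) ∣[(2 : ℤ)] (Matrix.SpecialLinearGroup.mapGL ℝ γ)⁻¹ = _
  rw [← map_inv]
  rfl

theorem card_quotient_GD7 : Nat.card (𝒮ℒ ⧸ GD7.subgroupOf 𝒮ℒ) = 56 := by
  have h : GD7.relIndex 𝒮ℒ = 56 := by
    rw [MonoidHom.range_eq_map,
      Subgroup.relIndex_map_map_of_injective _ _ Matrix.SpecialLinearGroup.mapGL_injective,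
      Subgroup.relIndex_top_right, index_D7]
  exact h

theorem slash_eq_of_mem_D7 (f : CuspForm GD7 2) {γ : SL(2, ℤ)} (h : γ ∈ D7) :
    (f : ℍ → ℂ) ∣[(2 : ℤ)] γ = f :=
  f.slash_action_eq' _ (mem_GD7 h)

theorem mdifferentiable_slash (f : CuspForm GD7 2) (γ : SL(2, ℤ)) :
    MDiff ((f : ℍ → ℂ) ∣[(2 : ℤ)] γ) :=
  (CuspForm.translate f (Matrix.SpecialLinearGroup.mapGL ℝ γ)).holo'

theorem conj_T_pow_seven_mem (γ : SL(2, ℤ)) : γ * ModularGroup.T ^ 7 * γ⁻¹ ∈ D7 := by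
  have h : Matrix.SpecialLinearGroup.map (Int.castRingHom (ZMod 7)) (ModularGroup.T ^ 7) = 1 := by
    have h0 : ModularGroup.T ^ 7 = mkSL 1 7 0 1 (by ring) :=
      Subtype.ext (by simpa using! ModularGroup.coe_T_zpow 7)
    have h7 : (7 : ZMod 7) = 0 := rfl
    rw [h0]
    ext i j
    fin_cases i <;> fin_cases j <;> simp [h7]
  rw [D7, Subgroup.mem_comap, map_mul, map_mul, h, mul_one, map_inv, mul_inv_cancel]
  exact one_mem _

theorem slash_T_zpow (f : ℍ → ℂ) (n : ℤ) (τ : ℍ) :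
    (f ∣[(2 : ℤ)] (ModularGroup.T ^ n)) τ = f (ModularGroup.T ^ n • τ) := by
  rw [ModularForm.SL_slash_apply, ModularGroup.denom_apply, ModularGroup.coe_T_zpow]
  simp

/-- T⁷ is trivial modulo 7, so every translate has period 7, and a cusp form decays at least like
exp(2πiτ/7). -/
theorem slash_isBigO (f : CuspForm GD7 2) (γ : SL(2, ℤ)) :
    ((f : ℍ → ℂ) ∣[(2 : ℤ)] γ) =O[atImInfty]
      fun τ : ℍ => Real.exp (-2 * Real.pi * τ.im / 7) := by
  have hper : Function.Periodic (((f : ℍ → ℂ) ∣[(2 : ℤ)] γ) ∘ ofComplex) (7 : ℝ) := by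
    have h1 : ((f : ℍ → ℂ) ∣[(2 : ℤ)] γ) ∣[(2 : ℤ)] (ModularGroup.T ^ 7) =
        (f : ℍ → ℂ) ∣[(2 : ℤ)] γ := by
      rw [← SlashAction.slash_mul, show γ * ModularGroup.T ^ 7 =
        (γ * ModularGroup.T ^ 7 * γ⁻¹) * γ by group, SlashAction.slash_mul,
        slash_eq_of_mem_D7 f (conj_T_pow_seven_mem γ)]
    intro w
    by_cases hw : 0 < w.im
    · have hw' : 0 < (w + (7 : ℝ)).im := by simpa using hw
      have h2 := slash_T_zpow ((f : ℍ → ℂ) ∣[(2 : ℤ)] γ) 7 ⟨w, hw⟩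
      rw [zpow_ofNat, h1, ← zpow_ofNat] at h2
      rw [Function.comp_apply, Function.comp_apply, ofComplex_apply_of_im_pos hw,
        ofComplex_apply_of_im_pos hw', h2]
      refine congrArg _ (UpperHalfPlane.ext ?_)
      rw [ModularGroup.coe_T_zpow_smul_eq]
      simp
    · have hw' : ¬ 0 < (w + (7 : ℝ)).im := by simpa using hw
      rw [Function.comp_apply, Function.comp_apply, ofComplex_apply_of_im_nonpos (not_lt.mp hw),
        ofComplex_apply_of_im_nonpos (not_lt.mp hw')]
  exact (CuspFormClass.zero_at_infty_slash f γ).exp_decay_atImInfty (by norm_num) hper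
    (mdifferentiable_slash f γ) (ModularFormClass.bdd_at_infty_slash f γ)

theorem slash_T_isBigO (f : CuspForm GD7 2)
    (hf : f =O[atImInfty] fun τ : ℍ => Real.exp (-4 * Real.pi * τ.im / 7)) (n : ℕ) :
    ((f : ℍ → ℂ) ∣[(2 : ℤ)] (ModularGroup.T ^ n)⁻¹) =O[atImInfty]
      fun τ : ℍ => Real.exp (-4 * Real.pi * τ.im / 7) := by
  rw [← zpow_natCast, ← zpow_neg]
  have ht : Tendsto (fun τ : ℍ => ModularGroup.T ^ (-n : ℤ) • τ) atImInfty atImInfty := by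
    refine tendsto_comap_iff.mpr (tendsto_comap.congr fun τ => ?_)
    exact (ModularGroup.im_T_zpow_smul τ _).symm
  refine (hf.comp_tendsto ht).congr (fun τ => ?_) (fun τ => ?_)
  · exact (slash_T_zpow f _ τ).symm
  · rw [Function.comp_apply, ModularGroup.im_T_zpow_smul]

/-! ### Forced zeros at the elliptic point ρ -/

/-- The point `(-1 + √-3) / 2`. -/
def rhoPt : ℍ := ⟨⟨-1 / 2, √3 / 2⟩, by simp⟩

theorem rhoPt_relation : (rhoPt : ℂ) ^ 2 + rhoPt + 1 = 0 := by
  have h3 : √3 * √3 = 3 := Real.mul_self_sqrt (by norm_num)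
  apply Complex.ext
  · simp [rhoPt, pow_two]
    linear_combination -h3 / 4
  · simp [rhoPt, pow_two]
    ring

theorem ST_smul_rhoPt : (ModularGroup.S * ModularGroup.T) • rhoPt = rhoPt := by
  have h := rhoPt_relation
  rw [mul_smul]
  ext
  have h1 : ((ModularGroup.T • rhoPt : ℍ) : ℂ) = rhoPt + 1 := by
    simpa using ModularGroup.coe_T_zpow_smul_eq (z := rhoPt) (n := 1)
  rw [UpperHalfPlane.modular_S_smul, UpperHalfPlane.coe_mk, h1]
  have h2 : (rhoPt : ℂ) + 1 ≠ 0 := by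
    rw [← h1]
    exact UpperHalfPlane.ne_zero _
  rw [inv_eq_iff_eq_inv, eq_comm]
  apply inv_eq_of_mul_eq_one_right
  linear_combination -h

/-- ST fixes ρ with automorphy factor (ρ + 1)² = ρ ≠ 1, so invariance in weight 2 forces the value
at ρ to vanish. -/
theorem slash_apply_rhoPt_eq_zero {f : ℍ → ℂ}
    (hf : f ∣[(2 : ℤ)] (ModularGroup.S * ModularGroup.T) = f) : f rhoPt = 0 := by
  have h := congrFun hf rhoPt
  rw [ModularForm.SL_slash_apply, ST_smul_rhoPt] at h
  have hd : denom (ModularGroup.S * ModularGroup.T : SL(2, ℤ)) rhoPt = rhoPt + 1 := by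
    rw [ModularGroup.denom_apply, Matrix.SpecialLinearGroup.coe_mul]
    simp [ModularGroup.S, ModularGroup.T]
  have h0 := rhoPt_relation
  have h1 : ((rhoPt : ℂ) + 1) ^ 2 = rhoPt := by linear_combination h0
  rw [hd, zpow_neg, zpow_ofNat, h1, mul_inv_eq_iff_eq_mul₀ (UpperHalfPlane.ne_zero _)] at h
  have h2 : (f rhoPt) * (1 - rhoPt) = 0 := by linear_combination h
  refine (mul_eq_zero.mp h2).resolve_right fun h3 => ?_
  rw [← (sub_eq_zero.mp h3)] at h0
  norm_num at h0

theorem slash_rhoPt_eq_zero (f : CuspForm GD7 2) {γ : SL(2, ℤ)}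
    (h : γ * (ModularGroup.S * ModularGroup.T) * γ⁻¹ ∈ D7) :
    ((f : ℍ → ℂ) ∣[(2 : ℤ)] γ) rhoPt = 0 := by
  apply slash_apply_rhoPt_eq_zero
  rw [← SlashAction.slash_mul, show γ * (ModularGroup.S * ModularGroup.T) =
    (γ * (ModularGroup.S * ModularGroup.T) * γ⁻¹) * γ by group, SlashAction.slash_mul,
    slash_eq_of_mem_D7 f h]

/-- A matrix conjugating the elliptic element `ST` into `D7`. -/
def ellipticConj : SL(2, ℤ) := mkSL 1 3 4 13 (by norm_num)

/-- The characteristic polynomial x² - x + 1 of ST has the roots 3 and 5 modulo 7. The rows (1, 3)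
and (4, 13) of `ellipticConj` are left eigenvectors for them, the second lifted so that the
determinant is 1. -/
theorem ellipticConj_mem :
    ellipticConj * (ModularGroup.S * ModularGroup.T) * ellipticConj⁻¹ ∈ D7 := by
  rw [mem_D7]
  decide

/-- Left multiplication by S exchanges the two eigenvector rows up to sign. This gives a second
coset, distinct from the first since S is not diagonal modulo 7. -/
theorem S_mul_ellipticConj_mem :
    ModularGroup.S * ellipticConj * (ModularGroup.S * ModularGroup.T) *
      (ModularGroup.S * ellipticConj)⁻¹ ∈ D7 := by
  rw [mem_D7]
  decide

theorem S_notMem_D7 : ModularGroup.S ∉ D7 := by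
  rw [mem_D7]
  decide

theorem T_pow_mem_D7 {n : ℤ} : ModularGroup.T ^ n ∈ D7 ↔ ((n : ℤ) : ZMod 7) = 0 := by
  rw [mem_D7, ModularGroup.coe_T_zpow]
  simp

theorem cosetD7_T_injective : Function.Injective fun j : Fin 7 =>
    cosetD7 (ModularGroup.T ^ (j : ℕ)) := by
  intro i j h
  have h1 := cosetD7_eq_iff.mp h
  rw [← zpow_natCast, ← zpow_natCast, ← zpow_neg, ← zpow_add, T_pow_mem_D7,
    ZMod.intCast_zmod_eq_zero_iff_dvd] at h1
  ext
  omega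

open Derivative in
/-- A cusp form of weight `2` on `GD7` whose expansion in `exp (2 π i τ / 7)` starts at the
second term vanishes. -/
theorem eq_zero_of_isBigO (f : CuspForm GD7 2)
    (hf : f =O[atImInfty] fun τ : ℍ => Real.exp (-4 * Real.pi * τ.im / 7)) : f = 0 := by
  classical
  let _ := Fintype.ofFinite (𝒮ℒ ⧸ GD7.subgroupOf 𝒮ℒ)
  set u : 𝒮ℒ ⧸ GD7.subgroupOf 𝒮ℒ → ℍ → ℂ := SlashInvariantForm.quotientFunc f with hu
  have hcard : Fintype.card (𝒮ℒ ⧸ GD7.subgroupOf 𝒮ℒ) = 56 := by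
    rw [← Nat.card_eq_fintype_card, card_quotient_GD7]
  let F : ModularForm 𝒮ℒ 112 :=
    ModularForm.mcast (by rw [card_quotient_GD7]; norm_num) (ModularForm.norm 𝒮ℒ f) rfl
  have hF : (F : ℍ → ℂ) = ∏ q, u q := ModularForm.coe_norm 𝒮ℒ f
  have hmd : ∀ q, MDiff (u q) := by
    intro q
    obtain ⟨γ, rfl⟩ := cosetD7_surjective q
    rw [hu, quotientFunc_cosetD7]
    exact mdifferentiable_slash f _
  let s : Finset (𝒮ℒ ⧸ GD7.subgroupOf 𝒮ℒ) :=
    Finset.univ.image fun j : Fin 7 => cosetD7 (ModularGroup.T ^ (j : ℕ))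
  have hs : s.card = 7 := by
    rw [Finset.card_image_of_injective _ cosetD7_T_injective, Finset.card_univ, Fintype.card_fin]
  have hbound : ∀ q, u q =O[atImInfty] fun τ : ℍ =>
      Real.exp (-2 * Real.pi * τ.im / 7) *
        if q ∈ s then Real.exp (-2 * Real.pi * τ.im / 7) else 1 := by
    intro q
    by_cases hq : q ∈ s
    · obtain ⟨j, -, rfl⟩ := Finset.mem_image.mp hq
      simp only [if_pos hq]
      rw [hu, quotientFunc_cosetD7]
      refine (slash_T_isBigO f hf j).congr_right fun τ => ?_
      rw [← Real.exp_add]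
      ring_nf
    · simp only [if_neg hq, mul_one]
      obtain ⟨γ, rfl⟩ := cosetD7_surjective q
      rw [hu, quotientFunc_cosetD7]
      exact slash_isBigO f _
  -- The orders add up to (56 + 7)/7 = 9: one for each of the 56 cosets and one more for each of the
  -- seven cosets of Tʲ.
  have hFO : F =O[atImInfty] fun τ : ℍ => Real.exp (-18 * Real.pi * τ.im) := by
    rw [hF]
    refine (IsBigO.finsetProd (s := Finset.univ) fun q _ => hbound q).congr (fun τ => ?_)
      fun τ => ?_
    · rw [Finset.prod_apply]
    · rw [Finset.prod_mul_distrib, Finset.prod_const, Finset.prod_ite_mem, Finset.univ_inter,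
        Finset.prod_const, Finset.card_univ, hcard, hs, ← pow_add, ← Real.exp_nat_mul]
      push_cast
      ring_nf
  set q₁ := cosetD7 ellipticConj⁻¹ with hq₁
  set q₂ := cosetD7 (ModularGroup.S * ellipticConj)⁻¹ with hq₂
  have hne : q₂ ≠ q₁ := by
    rw [hq₁, hq₂, Ne, cosetD7_eq_iff, inv_inv, mul_inv_cancel_right]
    exact S_notMem_D7
  have hu₁ : u q₁ rhoPt = 0 := by
    rw [hu, quotientFunc_cosetD7, inv_inv]
    exact slash_rhoPt_eq_zero f ellipticConj_mem
  have hu₂ : u q₂ rhoPt = 0 := by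
    rw [hu, quotientFunc_cosetD7, inv_inv]
    exact slash_rhoPt_eq_zero f S_mul_ellipticConj_mem
  -- One vanishing factor is split off; the remaining product still contains the other, so by the
  -- product rule the norm vanishes to order at least 2 at ρ.
  have hF1 : (F : ℍ → ℂ) = u q₁ * ∏ q ∈ Finset.univ.erase q₁, u q := by
    rw [hF, Finset.mul_prod_erase _ _ (Finset.mem_univ _)]
  have hv : (∏ q ∈ Finset.univ.erase q₁, u q) rhoPt = 0 := by
    rw [Finset.prod_apply]
    exact Finset.prod_eq_zero (Finset.mem_erase.mpr ⟨hne, Finset.mem_univ _⟩) hu₂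
  have hmv : MDiff (∏ q ∈ Finset.univ.erase q₁, u q) := MDifferentiable.prod fun q _ => hmd q
  have hF0 : F = 0 := by
    refine eq_zero_of_weight_112 F (τ := rhoPt) hFO ?_ ?_
    · rw [hF1, Pi.mul_apply, hu₁, zero_mul]
    · rw [hF1, normalizedDerivOfComplex_mul _ _ (hmd _) hmv]
      simp [hu₁, hv]
  have hnorm : ModularForm.norm 𝒮ℒ f = 0 := by
    ext τ
    exact DFunLike.congr_fun hF0 τ
  exact DFunLike.coe_injective ((ModularForm.norm_eq_zero_iff 𝒮ℒ f).mp hnorm)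

end

/-! ### The order `ℤ[(1 + √-7) / 2]` and the lattice sum of `formG` -/

/-- The ring `ℤ[ω]` with `ω ^ 2 = ω - 2`. -/
abbrev O7 : Type := QuadraticAlgebra ℤ (-2) 1

open QuadraticAlgebra in
theorem norm_O7 (α : O7) : α.norm = normForm (α.re, α.im) := by
  rw [norm_def, normForm]
  ring

theorem norm_O7_pos {α : O7} (h : α ≠ 0) : 0 < α.norm := by
  rw [norm_O7]
  refine normForm_pos fun h0 => h ?_
  rw [Prod.mk.injEq] at h0
  exact QuadraticAlgebra.ext h0.1 h0.2

/-- The residue character `chi7 (α mod √-7)`. -/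
def charO7 (α : O7) : ℂ := chi7 ((α.re + 4 * α.im : ℤ) : ZMod 7)

/-- The embedding of `ℤ[ω]` in `ℂ` sending `ω` to `(1 + √-7) / 2`. -/
def embO7 (α : O7) : ℂ := α.re + α.im * ((1 + √7 * Complex.I) / 2)

theorem sqrt_seven_mul_I_sq : ((√7 : ℝ) * Complex.I : ℂ) ^ 2 = -7 := by
  rw [mul_pow, Complex.I_sq, ← Complex.ofReal_pow, Real.sq_sqrt (by norm_num)]
  norm_num

theorem charO7_mul (α β : O7) : charO7 (α * β) = charO7 α * charO7 β := by
  rw [charO7, charO7, charO7, ← map_mul, ← Int.cast_mul]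
  congr 1
  rw [ZMod.intCast_eq_intCast_iff_dvd_sub]
  refine ⟨2 * α.im * β.im, ?_⟩
  simp only [QuadraticAlgebra.re_mul, QuadraticAlgebra.im_mul]
  ring

theorem embO7_mul (α β : O7) : embO7 (α * β) = embO7 α * embO7 β := by
  simp only [embO7, QuadraticAlgebra.re_mul, QuadraticAlgebra.im_mul]
  push_cast
  linear_combination (-(α.im * β.im / 4) : ℂ) * sqrt_seven_mul_I_sq

theorem charO7_star (α : O7) : charO7 (star α) = charO7 α := by
  rw [charO7, charO7]
  congr 1
  rw [ZMod.intCast_eq_intCast_iff_dvd_sub]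
  refine ⟨α.im, ?_⟩
  simp only [QuadraticAlgebra.re_star, QuadraticAlgebra.im_star]
  ring

theorem embO7_add_star (α : O7) : embO7 α + embO7 (star α) = 2 * α.re + α.im := by
  simp only [embO7, QuadraticAlgebra.re_star, QuadraticAlgebra.im_star]
  push_cast
  ring

theorem charO7_intCast (n : ℤ) : charO7 n = chi7 (n : ZMod 7) := by
  simp [charO7]

theorem embO7_intCast (n : ℤ) : embO7 n = n := by
  simp [embO7]

theorem charO7_sq (α : O7) : charO7 α ^ 2 = chi7 (α.norm : ZMod 7) := by
  rw [charO7, ← map_pow, ← Int.cast_pow]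
  congr 1
  rw [ZMod.intCast_eq_intCast_iff_dvd_sub, norm_O7]
  refine ⟨-(α.re * α.im) - 2 * α.im ^ 2, ?_⟩
  rw [normForm]
  ring

/-- The general term of the lattice sum of `formG`. -/
def latTerm (τ : ℂ) (α : O7) : ℂ :=
  charO7 α * embO7 α * Complex.exp (2 * Real.pi * Complex.I * τ * α.norm)

theorem latTerm_mul (τ : ℂ) (α β : O7) :
    latTerm τ (α * β) = charO7 α * embO7 α * latTerm (α.norm * τ) β := by
  rw [latTerm, latTerm, charO7_mul, embO7_mul, map_mul]
  push_cast
  ring_nf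

theorem hasSum_latTerm_re {τ : ℂ} (hτ : 0 < τ.im) :
    HasSum (fun α : O7 => charO7 α * (α.re + α.im / 2) *
      Complex.exp (2 * Real.pi * Complex.I * τ * α.norm)) (theta chi7 (7 * τ)) := by
  have h7 : 0 < (7 * τ : ℂ).im := by simpa using hτ
  have h := (QuadraticAlgebra.equivProd (-2 : ℤ) 1).hasSum_iff.mpr
    (summable_thetaTerm chi7 h7).hasSum
  refine hasSum_of_eq h (fun α => ?_) rfl
  rw [norm_O7]
  simp only [Function.comp_apply, thetaTerm, charO7, QuadraticAlgebra.equivProd]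
  congr 2
  simp only [Equiv.coe_fn_mk]
  ring

/-- Only the sum weighted by Re(α) is known to converge. The imaginary part comes from Re(ωα): Re(α)
- 2 Re(ωα) is 7/2 times the ω-coordinate of α, and passing to τ/2 compensates for N(ω) = 2. -/
theorem summable_latTerm {τ : ℂ} (hτ : 0 < τ.im) : Summable (latTerm τ) := by
  have h2 : 0 < (τ / 2 : ℂ).im := by simpa using hτ
  let w : O7 := ⟨0, 1⟩
  have hinj : Function.Injective fun α : O7 => w * α := by
    intro α β h
    have h1 := congrArg QuadraticAlgebra.re h
    have h2 := congrArg QuadraticAlgebra.im h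
    simp only [QuadraticAlgebra.re_mul, QuadraticAlgebra.im_mul, w] at h1 h2
    ext <;> omega
  have s1 := (hasSum_latTerm_re hτ).summable
  have s2 := ((hasSum_latTerm_re h2).summable.comp_injective hinj)
  have hw : charO7 w = 1 := by
    simp [charO7, w, chi7_values]
  have hn : w.norm = 2 := by
    rw [norm_O7]
    rfl
  refine (s1.add ((s1.sub (s2.mul_left 2)).mul_left (2 / 7 * (√7 * Complex.I / 2)))).congr
    fun α => ?_
  simp only [Function.comp_apply, charO7_mul, hw, map_mul, hn, latTerm, embO7,
    QuadraticAlgebra.re_mul, QuadraticAlgebra.im_mul]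
  rw [show 2 * (Real.pi : ℂ) * Complex.I * (τ / 2) * ((2 * α.norm : ℤ) : ℂ) =
    2 * Real.pi * Complex.I * τ * α.norm by push_cast; ring]
  simp only [w]
  push_cast
  ring

/-- Conjugation preserves χ and the norm, so averaging over it replaces the weight α by Re(α). -/
theorem hasSum_latTerm (τ : ℍ) : HasSum (latTerm τ) (2 * formG τ) := by
  have h := (summable_latTerm τ.im_pos).hasSum
  have hs : HasSum (fun α => latTerm τ (star α)) (∑' α, latTerm τ α) :=
    (Equiv.hasSum_iff (star_involutive (R := O7)).toPerm).mpr h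
  have h2 := (h.add hs).div_const 2
  have h3 := hasSum_latTerm_re τ.im_pos
  have h4 : (fun α => (latTerm τ α + latTerm τ (star α)) / 2) = fun α : O7 =>
      charO7 α * (α.re + α.im / 2) *
        Complex.exp (2 * Real.pi * Complex.I * τ * α.norm) := by
    ext α
    rw [latTerm, latTerm, charO7_star, QuadraticAlgebra.norm_star]
    linear_combination (charO7 α / 2 * Complex.exp (2 * Real.pi * Complex.I * τ * α.norm)) *
      embO7_add_star α
  rw [h4] at h2
  have h5 := h2.unique h3
  refine hasSum_of_eq h (fun _ => rfl) ?_
  rw [formG_apply, ← h5]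
  ring

-- Multiplication by η is injective and all three factors of a term are multiplicative. This yields
-- both the Hecke action and the identity at 2.
open Classical in
theorem hasSum_latTerm_dvd {η : O7} (hη : η ≠ 0) {τ σ : ℍ} (h : (σ : ℂ) = η.norm * τ) :
    HasSum (fun α => if η ∣ α then latTerm τ α else 0)
      (charO7 η * embO7 η * (2 * formG σ)) := by
  have hinj : Function.Injective fun α : O7 => η * α := by
    intro α β hαβ
    have h1 : star η * (η * (α - β)) = 0 := by
      rw [mul_sub, sub_eq_zero.mpr hαβ, mul_zero]
    rw [← mul_assoc, mul_comm (star η), ← QuadraticAlgebra.algebraMap_norm_eq_mul_star,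
      QuadraticAlgebra.algebraMap_eq] at h1
    have h2 := congrArg QuadraticAlgebra.re h1
    have h3 := congrArg QuadraticAlgebra.im h1
    simp only [QuadraticAlgebra.re_mul, QuadraticAlgebra.im_mul, QuadraticAlgebra.re_sub,
      QuadraticAlgebra.im_sub, QuadraticAlgebra.re_zero, QuadraticAlgebra.im_zero] at h2 h3
    have hn := (norm_O7_pos hη).ne'
    have h4 : η.norm * (α.re - β.re) = 0 := by linear_combination h2
    have h5 : η.norm * (α.im - β.im) = 0 := by linear_combination h3
    ext
    · exact sub_eq_zero.mp ((mul_eq_zero.mp h4).resolve_left hn)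
    · exact sub_eq_zero.mp ((mul_eq_zero.mp h5).resolve_left hn)
  refine (hinj.hasSum_iff ?_).mp ?_
  · intro α hα
    refine if_neg fun ⟨β, hβ⟩ => hα ⟨β, hβ.symm⟩
  · refine hasSum_of_eq ((hasSum_latTerm σ).mul_left _) (fun α => ?_) rfl
    simp only [Function.comp_apply]
    rw [if_pos (dvd_mul_right _ _), latTerm_mul, h]

/-! ### The identity for `Psi` -/

/-- The element `(1 + √-7) / 2`. -/
def omegaO7 : O7 := ⟨0, 1⟩

theorem omegaO7_dvd {α : O7} : omegaO7 ∣ α ↔ Even α.re := by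
  constructor
  · rintro ⟨β, rfl⟩
    exact ⟨-β.im, by simp only [omegaO7, QuadraticAlgebra.re_mul]; ring⟩
  · rintro ⟨r, hr⟩
    refine ⟨⟨α.im + r, -r⟩, QuadraticAlgebra.ext ?_ ?_⟩ <;> simp only [omegaO7, hr,
      QuadraticAlgebra.re_mul, QuadraticAlgebra.im_mul] <;> ring

theorem star_omegaO7_dvd {α : O7} : star omegaO7 ∣ α ↔ Even (α.re + α.im) := by
  constructor
  · rintro ⟨β, rfl⟩
    exact ⟨β.im, by simp [omegaO7]; ring⟩
  · rintro ⟨r, hr⟩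
    refine ⟨⟨-α.im, r⟩, QuadraticAlgebra.ext ?_ ?_⟩ <;> simp [omegaO7]
    linear_combination hr

theorem intCast_dvd_O7 {n : ℤ} {α : O7} : (n : O7) ∣ α ↔ n ∣ α.re ∧ n ∣ α.im := by
  constructor
  · rintro ⟨β, rfl⟩
    simp
  · rintro ⟨⟨r, hr⟩, ⟨s, hs⟩⟩
    exact ⟨⟨r, s⟩, QuadraticAlgebra.ext (by simp [hr]) (by simp [hs])⟩

theorem norm_omegaO7 : omegaO7.norm = 2 := by
  rw [norm_O7]
  rfl

theorem charO7_omegaO7 : charO7 omegaO7 = 1 := by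
  simp [charO7, omegaO7, chi7_values]

theorem embO7_omegaO7_add_star : embO7 omegaO7 + embO7 (star omegaO7) = 1 := by
  rw [embO7_add_star]
  simp [omegaO7]

theorem ne_zero_of_norm_ne_zero {α : O7} (h : α.norm ≠ 0) : α ≠ 0 := by
  rintro rfl
  exact h QuadraticAlgebra.norm_zero

/-- Evenness of the ω-coordinate describes ℤ[√-7]. Its indicator is 1 - [ω ∣ α] - [ω̄ ∣ α] + 2[2 ∣
α], as the four parity classes show. -/
theorem hasSum_latTerm_even (τ : ℍ) :
    HasSum (fun α : O7 => if Even α.im then latTerm τ α else 0)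
      (2 * (formG τ - dilate 2 formG τ + 4 * dilate 4 formG τ)) := by
  classical
  have h1 := hasSum_latTerm τ
  have h2 := hasSum_latTerm_dvd (η := omegaO7) (τ := τ) (σ := mulPt 2 τ)
    (ne_zero_of_norm_ne_zero (by rw [norm_omegaO7]; norm_num)) (by rw [norm_omegaO7]; simp [mulPt])
  have h3 := hasSum_latTerm_dvd (η := star omegaO7) (τ := τ) (σ := mulPt 2 τ)
    (ne_zero_of_norm_ne_zero (by rw [QuadraticAlgebra.norm_star, norm_omegaO7]; norm_num))
    (by rw [QuadraticAlgebra.norm_star, norm_omegaO7]; simp [mulPt])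
  have hn : (((2 : ℤ) : O7)).norm = 4 := by
    rw [QuadraticAlgebra.norm_intCast]
    norm_num
  have h4 := hasSum_latTerm_dvd (η := ((2 : ℤ) : O7)) (τ := τ) (σ := mulPt 4 τ)
    (ne_zero_of_norm_ne_zero (by rw [hn]; norm_num)) (by rw [hn]; simp [mulPt])
  refine hasSum_of_eq (((h1.sub h2).sub h3).add (h4.mul_left 2)) (fun α => ?_) ?_
  · simp only [omegaO7_dvd, star_omegaO7_dvd, intCast_dvd_O7, ← even_iff_two_dvd, Int.even_add]
    by_cases ha : Even α.re <;> by_cases hb : Even α.im <;> simp [ha, hb]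
    ring
  · rw [charO7_star, charO7_omegaO7, charO7_intCast, embO7_intCast]
    have hc : chi7 ((2 : ℤ) : ZMod 7) = 1 := chi7_values.2.2.1
    rw [hc, dilate, dilate]
    push_cast
    linear_combination (2 * formG (mulPt 2 τ)) * embO7_omegaO7_add_star

theorem hasSum_Psi_lattice (τ : ℍ) :
    HasSum (fun z : ℤ × ℤ => chi7 (z.1 : ZMod 7) * z.1 *
      Complex.exp (2 * Real.pi * Complex.I * τ * (z.1 ^ 2 + 7 * z.2 ^ 2 : ℤ)))
      (2 * (formG τ - dilate 2 formG τ + 4 * dilate 4 formG τ)) := by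
  let j : ℤ × ℤ → O7 := fun z => ⟨z.1 - z.2, 2 * z.2⟩
  have hj : Function.Injective j := by
    rintro ⟨a, b⟩ ⟨c, d⟩ h
    have h1 := congrArg QuadraticAlgebra.re h
    have h2 := congrArg QuadraticAlgebra.im h
    simp only [j] at h1 h2
    ext <;> simp only <;> omega
  have h := (hj.hasSum_iff (f := fun α : O7 => if Even α.im then latTerm τ α else 0)
    (fun α hα => if_neg fun ⟨r, hr⟩ => hα ⟨(α.re + r, r), QuadraticAlgebra.ext (by simp [j])
      (by simp only [j]; omega)⟩)).mpr (hasSum_latTerm_even τ)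
  have hterm : ∀ z : ℤ × ℤ, (if Even (j z).im then latTerm τ (j z) else 0) =
      chi7 (z.1 : ZMod 7) * (z.1 + z.2 * ((√7 : ℝ) * Complex.I)) *
      Complex.exp (2 * Real.pi * Complex.I * τ * (z.1 ^ 2 + 7 * z.2 ^ 2 : ℤ)) := by
    intro z
    rw [if_pos ⟨z.2, by simp only [j]; ring⟩, latTerm]
    have h1 : (j z).norm = z.1 ^ 2 + 7 * z.2 ^ 2 := by
      rw [norm_O7, normForm]
      simp only [j]
      ring
    have h2 : charO7 (j z) = chi7 (z.1 : ZMod 7) := by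
      rw [charO7]
      congr 1
      rw [ZMod.intCast_eq_intCast_iff_dvd_sub]
      exact ⟨-z.2, by simp only [j]; ring⟩
    have h3 : embO7 (j z) = z.1 + z.2 * ((√7 : ℝ) * Complex.I) := by
      simp only [embO7, j]
      push_cast
      ring
    rw [h1, h2, h3]
  have h' : HasSum (fun z : ℤ × ℤ => chi7 (z.1 : ZMod 7) *
      (z.1 + z.2 * ((√7 : ℝ) * Complex.I)) *
      Complex.exp (2 * Real.pi * Complex.I * τ * (z.1 ^ 2 + 7 * z.2 ^ 2 : ℤ)))
      (2 * (formG τ - dilate 2 formG τ + 4 * dilate 4 formG τ)) :=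
    hasSum_of_eq h (fun z => (hterm z).symm) rfl
  -- Averaging over y ↦ -y removes the √-7 part of the weight x + y√-7.
  have hneg := ((Equiv.refl ℤ).prodCongr (Equiv.neg ℤ)).hasSum_iff.mpr h'
  refine hasSum_of_eq ((h'.add hneg).div_const 2) (fun z => ?_) (by ring)
  simp only [Function.comp_apply, Equiv.prodCongr_apply, Prod.map_fst, Prod.map_snd,
    Equiv.refl_apply, Equiv.neg_apply, neg_sq]
  push_cast
  ring

theorem hasSum_fiber {ι : Type*} {d : ι → ℕ} {F : ℕ → Finset ι} (hF : ∀ n i, i ∈ F n ↔ d i = n)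
    {f : ι → ℂ} {S : ℂ} (h : HasSum f S) : HasSum (fun n => ∑ i ∈ F n, f i) S := by
  refine ((Equiv.sigmaFiberEquiv d).hasSum_iff.mpr h).sigma fun n => ?_
  let e : {i // d i = n} ≃ F n := Equiv.subtypeEquivRight fun i => (hF n i).symm
  exact e.hasSum_iff.mpr (Finset.hasSum (F n) f)

theorem nome_pow (τ : ℍ) (n : ℕ) :
    nome τ ^ n = Complex.exp (2 * Real.pi * Complex.I * τ * n) := by
  rw [nome, ← Complex.exp_nat_mul]
  ring_nf

theorem hasSum_psiCoeff (τ : ℍ) :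
    HasSum (fun n => psiCoeff 7 chi7 n * nome τ ^ n)
      (formG τ - dilate 2 formG τ + 4 * dilate 4 formG τ) := by
  have hF : ∀ (n : ℕ) (z : ℤ × ℤ), z ∈ reps 7 n ↔ (z.1 ^ 2 + 7 * z.2 ^ 2).toNat = n := by
    intro n z
    rw [mem_reps (by norm_num)]
    have : 0 ≤ z.1 ^ 2 + 7 * z.2 ^ 2 := by positivity
    push_cast
    omega
  refine hasSum_of_eq ((hasSum_fiber hF (hasSum_Psi_lattice τ)).div_const 2) (fun n => ?_) (by ring)
  rw [psiCoeff, mul_assoc, Finset.sum_mul, ← mul_div_right_comm, one_mul]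
  congr 1
  refine Finset.sum_congr rfl fun z hz => ?_
  rw [mem_reps (by norm_num)] at hz
  rw [nome_pow]
  congr 3
  have : ((z.1 ^ 2 + ((7 : ℕ) : ℤ) * z.2 ^ 2 : ℤ) : ℂ) = n := by rw [hz]; simp
  rw [← this]
  push_cast
  ring

theorem psiCoeff_zero : psiCoeff 7 chi7 0 = 0 := by
  have h : reps 7 0 = {(0, 0)} := by decide
  simp [psiCoeff, h]

theorem psiCoeff_one : psiCoeff 7 chi7 1 = 1 := by
  have h : reps 7 1 = {(1, 0), (-1, 0)} := by decide
  have h1 : chi7 (-1) = -1 := by rw [chi7_neg, map_one]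
  rw [psiCoeff, h, Finset.sum_pair (by decide)]
  simp [h1]
  norm_num

theorem hasSum_Psi (τ : ℍ) :
    HasSum (fun n => psiCoeff 7 chi7 (n + 1) * nome τ ^ (n + 1))
      (formG τ - dilate 2 formG τ + 4 * dilate 4 formG τ) := by
  have h := (hasSum_nat_add_iff' 1).mpr (hasSum_psiCoeff τ)
  simpa [psiCoeff_zero] using h

/-! ### Fourier coefficients -/

theorem qParam_one (τ : ℍ) : Function.Periodic.qParam 1 (τ : ℂ) = nome τ := by
  simp [Function.Periodic.qParam, nome]

theorem one_mem_strictPeriods_G0 (N : ℕ) : (1 : ℝ) ∈ (G0 N).strictPeriods := by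
  rw [Subgroup.mem_strictPeriods_iff]
  refine ⟨mkSL 1 1 0 1 (by ring), ?_, ?_⟩
  · simp
  · ext i j
    fin_cases i <;> fin_cases j <;> simp

theorem hasSum_fourierCoeff {N : ℕ} [NeZero N] {k : ℤ} (f : CuspForm (G0 N) k) (τ : ℍ) :
    HasSum (fun n => fourierCoeff f n * nome τ ^ n) (f τ) := by
  have : Fact (IsCusp OnePoint.infty (G0 N)) :=
    ⟨(G0 N).isCusp_of_mem_strictPeriods one_pos (one_mem_strictPeriods_G0 N)⟩
  have h := hasSum_qExpansion one_pos
    (SlashInvariantFormClass.periodic_comp_ofComplex f (one_mem_strictPeriods_G0 N)) f.holo'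
    (ModularFormClass.bdd_at_infty f) τ
  simpa [qParam_one, fourierCoeff] using h

theorem coeff_unique {c c' : ℕ → ℂ} {f : ℍ → ℂ}
    (h : ∀ τ, HasSum (fun n => c n * nome τ ^ n) (f τ))
    (h' : ∀ τ, HasSum (fun n => c' n * nome τ ^ n) (f τ)) : c = c' := by
  have key : ∀ τ : ℍ, HasSum (fun n => (c n - c' n) • Function.Periodic.qParam 1 (τ : ℂ) ^ n)
      ((0 : ModularForm 𝒮ℒ 0) τ) := fun τ =>
    hasSum_of_eq ((h τ).sub (h' τ)) (fun n => by rw [qParam_one, smul_eq_mul, sub_mul])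
      (by rw [sub_self]; rfl)
  ext n
  have h0 : (c n - c' n) = 0 := by
    rw [ModularFormClass.qExpansion_coeff_unique one_pos one_mem_strictPeriods_SL key n]
    change (qExpansion 1 (0 : ℍ → ℂ)).coeff n = 0
    rw [qExpansion_zero]
    simp
  exact sub_eq_zero.mp h0

theorem hasSum_dilate {N : ℕ} [NeZero N] {k : ℤ} (f : CuspForm (G0 N) k) (d : ℕ+) (τ : ℍ) :
    HasSum (fun n => (if (d : ℕ) ∣ n then fourierCoeff f (n / d) else 0) * nome τ ^ n)
      (dilate d f τ) := by
  have hinj : Function.Injective fun n : ℕ => (d : ℕ) * n :=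
    fun a b h => Nat.eq_of_mul_eq_mul_left d.pos h
  refine (hinj.hasSum_iff ?_).mp ?_
  · intro n hn
    rw [if_neg fun ⟨m, hm⟩ => hn ⟨m, hm.symm⟩, zero_mul]
  · refine hasSum_of_eq (hasSum_fourierCoeff f (mulPt d τ)) (fun n => ?_) rfl
    simp only [Function.comp_apply]
    rw [if_pos (dvd_mul_right _ _), Nat.mul_div_cancel_left _ d.pos, nome_pow, nome_pow, mulPt]
    push_cast
    ring_nf

theorem fourierCoeff_formG {n : ℕ} (hn : ¬ 2 ∣ n) :
    fourierCoeff formG n = psiCoeff 7 chi7 n := by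
  have h := coeff_unique (fun τ => hasSum_of_eq (((hasSum_fourierCoeff formG τ).sub
    (hasSum_dilate formG 2 τ)).add ((hasSum_dilate formG 4 τ).mul_left 4)) (g := fun n =>
      (fourierCoeff formG n - (if ((2 : ℕ+) : ℕ) ∣ n then fourierCoeff formG (n / (2 : ℕ+)) else 0)
        + 4 * (if ((4 : ℕ+) : ℕ) ∣ n then fourierCoeff formG (n / (4 : ℕ+)) else 0)) * nome τ ^ n)
      (fun n => by ring) rfl) hasSum_psiCoeff
  rw [← congrFun h n]
  have h2 : ¬ ((2 : ℕ+) : ℕ) ∣ n := hn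
  have h4 : ¬ ((4 : ℕ+) : ℕ) ∣ n := fun h => hn (dvd_trans ⟨2, rfl⟩ h)
  rw [if_neg h2, if_neg h4]
  ring

/-! ### Primes in `ℤ[ω]` -/

/-- Quadratic reciprocity: χ(p) tells whether p splits in O. -/
theorem quadraticChar_neg_seven {p : ℕ} [Fact p.Prime] (h2 : p ≠ 2) (h7 : p ≠ 7) :
    quadraticChar (ZMod 7) (p : ZMod 7) = quadraticChar (ZMod p) (-7) := by
  have h := quadraticChar_odd_prime (F := ZMod 7) (p := p) (by rw [ZMod.ringChar_zmod_n]; norm_num)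
    h2 (by rw [ZMod.ringChar_zmod_n]; exact h7.symm)
  rw [h, ZMod.card]
  congr 1
  have : ZMod.χ₄ ((7 : ℕ) : ZMod 4) = -1 := by decide
  rw [this]
  push_cast
  ring

/-- The quadratic form represents a small multiple of `p`. -/
theorem exists_small_multiple {p : ℕ} (hp : p.Prime) {t : ZMod p} (ht : t ^ 2 + t + 2 = 0) :
    ∃ α : O7, (p : ℤ) ∣ α.norm ∧ 0 < α.norm ∧ α.norm < 4 * p := by
  have : NeZero p := ⟨hp.ne_zero⟩
  set s := Nat.sqrt p with hs
  have hs1 : s * s ≤ p := Nat.sqrt_le p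
  have hs2 : p < (s + 1) * (s + 1) := Nat.lt_succ_sqrt p
  have hs3 : s * s ≠ p := fun h => by
    exact hp.prime.irreducible.not_isSquare ⟨s, h.symm⟩
  -- Thue's pigeonhole argument: there are (⌊√p⌋ + 1)² > p pairs. Two with equal x₁ - t x₂ differ by
  -- a (u, v) with u = tv modulo p, so p divides the norm, which is at most 4⌊√p⌋² < 4p.
  obtain ⟨x, hx, y, hy, hxy, hf⟩ := Finset.exists_ne_map_eq_of_card_lt_of_maps_to
    (s := Finset.range (s + 1) ×ˢ Finset.range (s + 1)) (t := (Finset.univ : Finset (ZMod p)))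
    (f := fun z => (z.1 : ZMod p) - t * z.2) (by simpa [ZMod.card] using hs2) (by simp)
  rw [Finset.mem_product, Finset.mem_range, Finset.mem_range] at hx hy
  have hne : (⟨(x.1 : ℤ) - y.1, (x.2 : ℤ) - y.2⟩ : O7) ≠ 0 := by
    intro h
    have h1 := congrArg QuadraticAlgebra.re h
    have h2 := congrArg QuadraticAlgebra.im h
    simp only [QuadraticAlgebra.re_zero, QuadraticAlgebra.im_zero] at h1 h2
    exact hxy (Prod.ext (by omega) (by omega))
  refine ⟨⟨x.1 - y.1, x.2 - y.2⟩, ?_, norm_O7_pos hne, ?_⟩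
  · rw [norm_O7, normForm, ← ZMod.intCast_zmod_eq_zero_iff_dvd]
    push_cast
    have h1 : (x.1 - y.1 : ZMod p) = t * (x.2 - y.2) := by
      linear_combination hf
    rw [h1]
    linear_combination (x.2 - y.2 : ZMod p) ^ 2 * ht
  · rw [norm_O7, normForm]
    simp only
    have hs4 : ((s : ℤ) * s) < p := by exact_mod_cast lt_of_le_of_ne hs1 hs3
    have b1 : |(x.1 : ℤ) - y.1| ≤ s := abs_le.mpr ⟨by omega, by omega⟩
    have b2 : |(x.2 : ℤ) - y.2| ≤ s := abs_le.mpr ⟨by omega, by omega⟩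
    generalize (x.1 : ℤ) - y.1 = u at b1
    generalize (x.2 : ℤ) - y.2 = v at b2
    have c1 : u ^ 2 ≤ (s : ℤ) ^ 2 := sq_le_sq' (abs_le.mp b1).1 (abs_le.mp b1).2
    have c2 : v ^ 2 ≤ (s : ℤ) ^ 2 := sq_le_sq' (abs_le.mp b2).1 (abs_le.mp b2).2
    nlinarith [sq_nonneg (u - v)]

theorem three_dvd_of_three_dvd_norm {α : O7} (h : (3 : ℤ) ∣ α.norm) :
    (3 : ℤ) ∣ α.re ∧ (3 : ℤ) ∣ α.im := by
  have key : ∀ u v : ZMod 3, u ^ 2 + u * v + 2 * v ^ 2 = 0 → u = 0 ∧ v = 0 := by decide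
  rw [norm_O7, normForm] at h
  have h1 := (ZMod.intCast_zmod_eq_zero_iff_dvd _ 3).mpr (by exact_mod_cast h)
  push_cast at h1
  obtain ⟨h2, h3⟩ := key _ _ h1
  exact ⟨(ZMod.intCast_zmod_eq_zero_iff_dvd _ 3).mp h2,
    (ZMod.intCast_zmod_eq_zero_iff_dvd _ 3).mp h3⟩

/-- The small multiple is p, 2p or 3p. A factor 2 is removed by dividing by ω or ω̄. As 3 is inert,
3p would force p = 3, where t² + t + 2 has no root. -/
theorem exists_norm_eq {p : ℕ} (hp : p.Prime) {t : ZMod p} (ht : t ^ 2 + t + 2 = 0) :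
    ∃ π : O7, π.norm = p := by
  obtain ⟨α, ⟨k, hk⟩, hpos, hlt⟩ := exists_small_multiple hp ht
  have hp0 : (0 : ℤ) < p := by exact_mod_cast hp.pos
  have hk0 : 0 < k := by
    by_contra h
    nlinarith
  have hk4 : k < 4 := by
    by_contra h
    nlinarith
  have hk' : k = 1 ∨ k = 2 ∨ k = 3 := by omega
  rcases hk' with rfl | rfl | rfl
  · exact ⟨α, by rw [hk, mul_one]⟩
  · have hev : Even (α.re * (α.re + α.im)) := by
      rw [norm_O7, normForm] at hk
      exact ⟨p - α.im ^ 2, by linear_combination hk⟩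
    rcases Int.even_mul.mp hev with h | h
    · obtain ⟨β, rfl⟩ := omegaO7_dvd.mpr h
      rw [map_mul, norm_omegaO7] at hk
      exact ⟨β, by linarith⟩
    · obtain ⟨β, rfl⟩ := star_omegaO7_dvd.mpr h
      rw [map_mul, QuadraticAlgebra.norm_star, norm_omegaO7] at hk
      exact ⟨β, by linarith⟩
  · exfalso
    obtain ⟨⟨r, hr⟩, ⟨s, hs⟩⟩ := three_dvd_of_three_dvd_norm (α := α) ⟨p, by rw [hk]; ring⟩
    rw [norm_O7, normForm, hr, hs] at hk
    have h3 : (3 : ℤ) ∣ p := ⟨r ^ 2 + r * s + 2 * s ^ 2, by linarith⟩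
    have h3' : p = 3 := ((Nat.prime_dvd_prime_iff_eq Nat.prime_three hp).mp
      (by exact_mod_cast h3)).symm
    subst h3'
    revert t
    decide

theorem not_dvd_im_of_norm_eq_prime {p : ℕ} (hp : p.Prime) {π : O7} (hπ : π.norm = p) :
    ¬ (p : ℤ) ∣ π.im := by
  have hpi : Prime (p : ℤ) := Nat.prime_iff_prime_int.mp hp
  have hN : π.re ^ 2 + π.re * π.im + 2 * π.im ^ 2 = p := by rw [← hπ, norm_O7, normForm]
  rintro ⟨b, hb⟩
  have ha : (p : ℤ) ∣ π.re ^ 2 := ⟨1 - b * π.re - 2 * b * π.im, by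
    linear_combination hN - (π.re + 2 * π.im) * hb⟩
  obtain ⟨a, ha⟩ := hpi.dvd_of_dvd_pow ha
  rw [ha, hb] at hN
  refine hpi.not_isUnit (IsUnit.of_mul_eq_one (a ^ 2 + a * b + 2 * b ^ 2) ?_)
  exact mul_left_cancel₀ hpi.ne_zero (by linear_combination hN)

/-- The right-hand side is the ω-coordinate of απ̄. Divisibility of the other coordinate follows
from it because p does not divide the ω-coordinate of π. -/
theorem dvd_of_norm_eq_prime {p : ℕ} (hp : p.Prime) {π : O7} (hπ : π.norm = p) (α : O7) :
    π ∣ α ↔ (p : ℤ) ∣ α.im * π.re - α.re * π.im := by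
  have hpi : Prime (p : ℤ) := Nat.prime_iff_prime_int.mp hp
  have hN : π.re ^ 2 + π.re * π.im + 2 * π.im ^ 2 = p := by rw [← hπ, norm_O7, normForm]
  constructor
  · rintro ⟨β, rfl⟩
    refine ⟨β.im, ?_⟩
    simp only [QuadraticAlgebra.re_mul, QuadraticAlgebra.im_mul]
    linear_combination β.im * hN
  · rintro ⟨s, hs⟩
    have hb := not_dvd_im_of_norm_eq_prime hp hπ
    have hr : (p : ℤ) ∣ π.im * (α.re * (π.re + π.im) + 2 * π.im * α.im) :=
      ⟨α.im - (π.re + π.im) * s, by linear_combination α.im * hN - (π.re + π.im) * hs⟩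
    obtain ⟨r, hr⟩ := (hpi.dvd_or_dvd hr).resolve_left hb
    refine ⟨⟨r, s⟩, QuadraticAlgebra.ext ?_ ?_⟩
    · refine mul_left_cancel₀ hpi.ne_zero ?_
      simp only [QuadraticAlgebra.re_mul]
      linear_combination -α.re * hN + π.re * hr - 2 * π.im * hs
    · refine mul_left_cancel₀ hpi.ne_zero ?_
      simp only [QuadraticAlgebra.im_mul]
      linear_combination -α.im * hN + π.im * hr + (π.re + π.im) * hs

theorem prime_dvd_norm_iff {p : ℕ} (hp : p.Prime) {π : O7} (hπ : π.norm = p) (α : O7) :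
    (p : ℤ) ∣ α.norm ↔ π ∣ α ∨ star π ∣ α := by
  have hpi : Prime (p : ℤ) := Nat.prime_iff_prime_int.mp hp
  constructor
  · intro h
    rw [dvd_of_norm_eq_prime hp hπ, dvd_of_norm_eq_prime hp (π := star π) (by
      rw [QuadraticAlgebra.norm_star, hπ])]
    apply hpi.dvd_or_dvd
    obtain ⟨k, hk⟩ := h
    have hN : π.re ^ 2 + π.re * π.im + 2 * π.im ^ 2 = p := by rw [← hπ, norm_O7, normForm]
    rw [norm_O7, normForm] at hk
    refine ⟨α.im ^ 2 - π.im ^ 2 * k, ?_⟩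
    simp only [QuadraticAlgebra.re_star, QuadraticAlgebra.im_star]
    linear_combination α.im ^ 2 * hN - π.im ^ 2 * hk
  · have key : ∀ η : O7, η.norm = p → η ∣ α → (p : ℤ) ∣ α.norm := by
      rintro η hη ⟨β, rfl⟩
      exact ⟨β.norm, by rw [map_mul, hη]⟩
    rintro (h | h)
    · exact key _ hπ h
    · exact key _ (by rw [QuadraticAlgebra.norm_star, hπ]) h

/-- Adding the two conditions gives p ∣ v(2a + b), with v the ω-coordinate of α and π = a + bω.
Since 4p = (2a + b)² + 7b², p ∣ 2a + b would force p = 7 or p ∣ b. -/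
theorem prime_dvd_iff {p : ℕ} (hp : p.Prime) (h7 : p ≠ 7) {π : O7} (hπ : π.norm = p) (α : O7) :
    ((p : ℤ) : O7) ∣ α ↔ π ∣ α ∧ star π ∣ α := by
  have hpi : Prime (p : ℤ) := Nat.prime_iff_prime_int.mp hp
  have hN : π.re ^ 2 + π.re * π.im + 2 * π.im ^ 2 = p := by rw [← hπ, norm_O7, normForm]
  rw [dvd_of_norm_eq_prime hp hπ, dvd_of_norm_eq_prime hp (π := star π) (by
      rw [QuadraticAlgebra.norm_star, hπ]), intCast_dvd_O7]
  simp only [QuadraticAlgebra.re_star, QuadraticAlgebra.im_star]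
  have hb := not_dvd_im_of_norm_eq_prime hp hπ
  constructor
  · rintro ⟨⟨r, hr⟩, ⟨s, hs⟩⟩
    exact ⟨⟨s * π.re - r * π.im, by rw [hr, hs]; ring⟩,
      ⟨s * (π.re + 1 * π.im) - r * -π.im, by rw [hr, hs]; ring⟩⟩
  · rintro ⟨h1, h2⟩
    have h3 : (p : ℤ) ∣ α.im * (2 * π.re + π.im) := by
      have := dvd_add h1 h2
      ring_nf at this ⊢
      exact this
    have hv : (p : ℤ) ∣ α.im := by
      refine (hpi.dvd_or_dvd h3).resolve_right fun ⟨c, hc⟩ => ?_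
      have h4 : (p : ℤ) ∣ 7 * π.im ^ 2 := ⟨4 - p * c ^ 2, by
        linear_combination 4 * hN - (2 * π.re + π.im + p * c) * hc⟩
      rcases hpi.dvd_or_dvd h4 with h | h
      · exact h7 ((Nat.prime_dvd_prime_iff_eq hp (by norm_num)).mp (by exact_mod_cast h))
      · exact hb (hpi.dvd_of_dvd_pow h)
    refine ⟨(hpi.dvd_or_dvd (b := π.im) ?_).resolve_right hb, hv⟩
    have h5 := dvd_sub (hv.mul_right π.re) h1
    rwa [sub_sub_cancel] at h5

/-- From 4N(α) = (2u + v)² + 7v², a nonzero v modulo p would exhibit -7 as a square. -/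
theorem inert_dvd {p : ℕ} (hp : p.Prime) (hns : ¬ IsSquare (-7 : ZMod p))
    {α : O7} (h : (p : ℤ) ∣ α.norm) : ((p : ℤ) : O7) ∣ α := by
  have : Fact p.Prime := ⟨hp⟩
  have hpi : Prime (p : ℤ) := Nat.prime_iff_prime_int.mp hp
  rw [norm_O7, normForm, ← ZMod.intCast_zmod_eq_zero_iff_dvd] at h
  push_cast at h
  rw [intCast_dvd_O7, ← ZMod.intCast_zmod_eq_zero_iff_dvd, ← ZMod.intCast_zmod_eq_zero_iff_dvd]
  have hv : (α.im : ZMod p) = 0 := by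
    by_contra hv
    refine hns ⟨(2 * α.re + α.im) / α.im, ?_⟩
    field_simp
    linear_combination -4 * h
  refine ⟨?_, hv⟩
  rw [hv] at h
  simpa using h

/-- For a prime `p ≠ 7`, either `p` is inert or it is a norm. -/
theorem inert_or_norm {p : ℕ} (hp : p.Prime) (h7 : p ≠ 7) :
    (chi7 (p : ZMod 7) = -1 ∧ ∀ α : O7, (p : ℤ) ∣ α.norm → ((p : ℤ) : O7) ∣ α) ∨
      chi7 (p : ZMod 7) = 1 ∧ ∃ π : O7, π.norm = p := by
  have : Fact p.Prime := ⟨hp⟩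
  by_cases h2 : p = 2
  · subst h2
    exact Or.inr ⟨chi7_values.2.2.1, omegaO7, norm_omegaO7⟩
  have hq := quadraticChar_neg_seven h2 h7
  have hne : (-7 : ZMod p) ≠ 0 := by
    intro h
    have h' : ((7 : ℕ) : ZMod p) = 0 := by
      push_cast
      linear_combination -h
    rw [ZMod.natCast_eq_zero_iff] at h'
    exact h7 ((Nat.prime_dvd_prime_iff_eq hp (by norm_num)).mp h')
  by_cases hsq : IsSquare (-7 : ZMod p)
  · right
    refine ⟨?_, ?_⟩
    · rw [chi7_apply, hq, (quadraticChar_one_iff_isSquare hne).mpr hsq, Int.cast_one]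
    · obtain ⟨r, hr⟩ := hsq
      have h2' : (2 : ZMod p) ≠ 0 := by
        intro h
        have h' : ((2 : ℕ) : ZMod p) = 0 := by exact_mod_cast h
        rw [ZMod.natCast_eq_zero_iff] at h'
        exact h2 ((Nat.prime_dvd_prime_iff_eq hp Nat.prime_two).mp h')
      refine exists_norm_eq hp (t := (r - 1) / 2) ?_
      field_simp
      linear_combination -hr
  · left
    refine ⟨?_, fun α h => inert_dvd hp hsq h⟩
    rw [chi7_apply, hq, quadraticChar_neg_one_iff_not_isSquare.mpr hsq]
    simp

/-! ### Hecke operators -/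

theorem sum_range_exp {p : ℕ} (hp : p ≠ 0) (n : ℤ) :
    ∑ j ∈ Finset.range p, Complex.exp (2 * Real.pi * Complex.I * (j * n / p)) =
      if (p : ℤ) ∣ n then (p : ℂ) else 0 := by
  have hp' : (p : ℂ) ≠ 0 := by exact_mod_cast hp
  set ζ := Complex.exp (2 * Real.pi * Complex.I * (n / p)) with hζ
  have h1 : ∀ j : ℕ, Complex.exp (2 * Real.pi * Complex.I * (j * n / p)) = ζ ^ j := by
    intro j
    rw [hζ, ← Complex.exp_nat_mul]
    ring_nf
  simp only [h1]
  have hpow : ζ ^ p = 1 := by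
    rw [hζ, ← Complex.exp_nat_mul, Complex.exp_eq_one_iff]
    exact ⟨n, by field_simp⟩
  have hone : ζ = 1 ↔ (p : ℤ) ∣ n := by
    rw [hζ, Complex.exp_eq_one_iff]
    constructor
    · rintro ⟨m, hm⟩
      refine ⟨m, ?_⟩
      have h2 : (2 * Real.pi * Complex.I : ℂ) * (n / p) = 2 * Real.pi * Complex.I * m := by
        rw [hm]; ring
      have h3 := mul_left_cancel₀ Complex.two_pi_I_ne_zero h2
      rw [div_eq_iff hp'] at h3
      have h4 : (n : ℂ) = (p * m : ℤ) := by
        push_cast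
        rw [h3, mul_comm]
      exact_mod_cast h4
    · rintro ⟨m, rfl⟩
      refine ⟨m, ?_⟩
      push_cast
      field_simp
  split_ifs with h
  · rw [hone.mpr h]
    simp
  · have h2 := mul_neg_geom_sum ζ p
    rw [hpow, sub_self] at h2
    exact (mul_eq_zero.mp h2).resolve_left fun h3 => h (hone.mp (sub_eq_zero.mp h3).symm)

/-- Averaging over the translates j is orthogonality of the p-th roots of unity, and it retains
exactly the α with p ∣ N(α). -/
theorem hasSum_latTerm_U (p : ℕ+) (τ : ℍ) :
    HasSum (fun α : O7 => if ((p : ℕ) : ℤ) ∣ α.norm then latTerm (divPt p 0 τ) α else 0)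
      (2 * (((p : ℕ) : ℂ)⁻¹ * ∑ j ∈ Finset.range p, formG (divPt p j τ))) := by
  have hp' : ((p : ℕ) : ℂ) ≠ 0 := by exact_mod_cast p.ne_zero
  have h := (hasSum_sum (s := Finset.range p) fun j _ => hasSum_latTerm (divPt p j τ)).mul_left
    (((p : ℕ) : ℂ)⁻¹)
  refine hasSum_of_eq h (fun α => ?_) (by rw [← Finset.mul_sum]; ring)
  have h1 : ∀ j : ℕ, latTerm (divPt p j τ) α = latTerm (divPt p 0 τ) α *
      Complex.exp (2 * Real.pi * Complex.I * (j * α.norm / (p : ℕ))) := by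
    intro j
    rw [latTerm, latTerm, mul_assoc _ (Complex.exp _), ← Complex.exp_add]
    congr 2
    simp only [divPt]
    push_cast
    ring
  rw [Finset.sum_congr rfl fun j _ => h1 j, ← Finset.mul_sum, sum_range_exp p.ne_zero]
  split_ifs
  · field_simp
  · simp

theorem heckeT_formG {p : ℕ+} (hp : (p : ℕ).Prime) :
    ∃ c : ℂ, ∀ τ : ℍ, heckeT 49 2 p formG τ = c * formG τ := by
  classical
  have hp' : ((p : ℕ) : ℂ) ≠ 0 := by exact_mod_cast p.ne_zero
  by_cases h7 : (p : ℕ) = 7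
  · refine ⟨0, fun τ => ?_⟩
    have h := hasSum_latTerm_U p τ
    have h0 : HasSum (fun α : O7 => if ((p : ℕ) : ℤ) ∣ α.norm then latTerm (divPt p 0 τ) α else 0)
        0 := by
      refine hasSum_of_eq hasSum_zero (fun α => ?_) rfl
      split_ifs with hd
      · rw [h7, ← ZMod.intCast_zmod_eq_zero_iff_dvd] at hd
        have hc := charO7_sq α
        rw [hd, chi7_values.1] at hc
        rw [latTerm, pow_eq_zero_iff (two_ne_zero) |>.mp hc, zero_mul, zero_mul]
      · rfl
    have h1 := h.unique h0
    rw [heckeT, if_pos (by rw [h7]; norm_num)]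
    linear_combination h1 / 2
  have h49 : ¬ (p : ℕ) ∣ 49 := by
    intro h
    rw [show 49 = 7 ^ 2 by norm_num] at h
    exact h7 ((Nat.prime_dvd_prime_iff_eq hp (by norm_num)).mp (hp.dvd_of_dvd_pow h))
  have hscalar : ∀ τ : ℍ, HasSum (fun α : O7 => if (((p : ℕ) : ℤ) : O7) ∣ α then
      latTerm (divPt p 0 τ) α else 0)
      (chi7 ((p : ℕ) : ZMod 7) * (p : ℕ) * (2 * dilate p formG τ)) := by
    intro τ
    refine hasSum_of_eq (hasSum_latTerm_dvd (η := (((p : ℕ) : ℤ) : O7)) (τ := divPt p 0 τ)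
      (σ := mulPt p τ) (ne_zero_of_norm_ne_zero ?_) ?_) (fun _ => rfl) ?_
    · rw [QuadraticAlgebra.norm_intCast]
      positivity
    · rw [QuadraticAlgebra.norm_intCast]
      simp only [mulPt, divPt]
      push_cast
      field_simp
      ring
    · rw [charO7_intCast, embO7_intCast, dilate]
      push_cast
      ring
  rcases inert_or_norm hp h7 with ⟨hchi, hin⟩ | ⟨hchi, π, hπ⟩
  · refine ⟨0, fun τ => ?_⟩
    have h1 := hscalar τ
    rw [hchi] at h1
    have h2 := hasSum_latTerm_U p τ
    have h3 := h2.unique (hasSum_of_eq h1 (fun α => by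
      have hiff : ((p : ℕ) : ℤ) ∣ α.norm ↔ (((p : ℕ) : ℤ) : O7) ∣ α := by
        refine ⟨hin α, fun ⟨β, hβ⟩ => ?_⟩
        rw [hβ, map_mul, QuadraticAlgebra.norm_intCast, sq, mul_assoc]
        exact dvd_mul_right _ _
      simp only [hiff]) rfl)
    rw [heckeT, if_neg h49]
    norm_num
    linear_combination h3 / 2
  · refine ⟨charO7 π * embO7 π + charO7 (star π) * embO7 (star π), fun τ => ?_⟩
    have h0 := hscalar τ
    rw [hchi] at h0
    have hη : ∀ η : O7, η.norm = (p : ℕ) → HasSum (fun α : O7 => if η ∣ α then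
        latTerm (divPt p 0 τ) α else 0) (charO7 η * embO7 η * (2 * formG τ)) := by
      intro η hn
      refine hasSum_latTerm_dvd (ne_zero_of_norm_ne_zero ?_) ?_
      · rw [hn]
        exact_mod_cast p.ne_zero
      · rw [hn]
        simp only [divPt]
        push_cast
        field_simp
        ring
    have h1 := hη π hπ
    have h2 := hη (star π) (by rw [QuadraticAlgebra.norm_star, hπ])
    -- Inclusion-exclusion: p ∣ N(α) means π ∣ α or π̄ ∣ α, and both hold exactly when p ∣ α.
    have h3 := (hasSum_latTerm_U p τ).unique (hasSum_of_eq ((h1.add h2).sub h0) (fun α => by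
      simp only [prime_dvd_norm_iff hp hπ, prime_dvd_iff hp h7 hπ]
      by_cases ha : π ∣ α <;> by_cases hb : star π ∣ α <;> simp [ha, hb]) rfl)
    rw [heckeT, if_neg h49]
    norm_num
    linear_combination h3 / 2

section

open scoped ModularForm
open Filter Asymptotics

/-! ### Newforms of level `49` -/

theorem exp_isBigO_exp {a b : ℝ} (h : b ≤ a) :
    (fun τ : ℍ => Real.exp (-a * τ.im)) =O[atImInfty] fun τ : ℍ => Real.exp (-b * τ.im) := by
  refine IsBigO.of_bound 1 (Eventually.of_forall fun τ => ?_)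
  rw [Real.norm_eq_abs, Real.norm_eq_abs, Real.abs_exp, Real.abs_exp, one_mul, Real.exp_le_exp]
  nlinarith [τ.im_pos]

theorem D7_le_Gamma0 {M : ℕ} (hM : M ∣ 7) : D7 ≤ CongruenceSubgroup.Gamma0 M := by
  intro γ hγ
  have hc := (mem_D7.mp hγ).2
  rw [ZMod.intCast_zmod_eq_zero_iff_dvd] at hc
  rw [CongruenceSubgroup.Gamma0_mem, ZMod.intCast_zmod_eq_zero_iff_dvd]
  exact (Int.natCast_dvd_natCast.mpr hM).trans hc

/-- Such a form restricts to `GD7` and decays like exp(2πiτ), the seventh power of exp(2πiτ/7), so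
the vanishing criterion applies. -/
theorem eq_zero_of_level_dvd_seven {M : ℕ} (hM : M ∣ 7) (g : CuspForm (G0 M) 2) :
    (g : ℍ → ℂ) = 0 := by
  have hle : GD7 ≤ G0 M := Subgroup.map_mono (D7_le_Gamma0 hM)
  have hg : (restrictCusp hle g : ℍ → ℂ) =O[atImInfty]
      fun τ : ℍ => Real.exp (-4 * Real.pi * τ.im / 7) := by
    have h := CuspFormClass.exp_decay_atImInfty g one_pos (one_mem_strictPeriods_G0 M)
    have h2 := exp_isBigO_exp (a := 2 * Real.pi) (b := 4 * Real.pi / 7)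
      (by linarith [Real.pi_pos])
    refine (h.congr_right fun τ => ?_).trans (h2.congr_right fun τ => ?_)
    · ring_nf
    · ring_nf
  have h := eq_zero_of_isBigO _ hg
  rw [← restrictCusp_coe hle g, h]
  rfl

/-- A proper divisor of 49 divides 7, so there are no nonzero oldforms to test against. -/
theorem isNew_formG : IsNew 49 2 formG := by
  intro M d hd hM g
  have hM' : M ∣ 7 := by
    have h1 : M ∣ 7 ^ 2 := dvd_of_mul_right_dvd hd
    obtain ⟨k, hk, rfl⟩ := (Nat.dvd_prime_pow (by norm_num)).mp h1
    interval_cases k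
    · norm_num
    · norm_num
    · norm_num at hM
  have h0 : dilate d g = 0 := by
    ext τ
    rw [dilate, eq_zero_of_level_dvd_seven hM' g]
    rfl
  rw [h0, peterssonInner]
  simp [petersson]

theorem isNewform_formG : IsNewform 49 2 formG where
  isNew := isNew_formG
  eigen _ hp := heckeT_formG hp
  normalised := by rw [fourierCoeff_formG (by norm_num), psiCoeff_one]

theorem isBigO_of_fourierCoeff_one_eq_zero (f : CuspForm (G0 49) 2) (h1 : fourierCoeff f 1 = 0) :
    f =O[atImInfty] fun τ : ℍ => Real.exp (-4 * Real.pi * τ.im) := by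
  have h0 : fourierCoeff f 0 = 0 :=
    CuspFormClass.qExpansion_coeff_zero f one_pos (one_mem_strictPeriods_G0 49)
  have hq : ∀ τ : ℍ, nome τ ≠ 0 := fun τ => Complex.exp_ne_zero _
  have hg : ∀ τ : ℍ, HasSum (fun n => fourierCoeff f (n + 2) •
      Function.Periodic.qParam 1 (τ : ℂ) ^ n) (f τ / nome τ ^ 2) := by
    intro τ
    have h2 := ((hasSum_nat_add_iff' 2).mpr (hasSum_fourierCoeff f τ)).div_const (nome τ ^ 2)
    refine hasSum_of_eq h2 (fun n => ?_) ?_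
    · rw [qParam_one, smul_eq_mul, pow_add, ← mul_assoc,
        mul_div_cancel_right₀ _ (pow_ne_zero _ (hq τ))]
    · simp [Finset.sum_range_succ, h0, h1]
  have hb := isBoundedAtImInfty_of_hasSum_qExpansion one_pos hg
  have h3 := IsBigO.mul hb (isBigO_refl (fun τ : ℍ => nome τ ^ 2) atImInfty).norm_right
  refine h3.congr (fun τ => ?_) (fun τ => ?_)
  · exact div_mul_cancel₀ _ (pow_ne_zero _ (hq τ))
  · rw [Pi.one_apply, one_mul, nome_pow, Complex.norm_exp]
    congr 1
    simp
    ring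

theorem slash_delta7_inv (f : ℍ → ℂ) (τ : ℍ) :
    (f ∣[(2 : ℤ)] delta7⁻¹) τ = 7⁻¹ * f (divPt 7 0 τ) := by
  have h := slash_delta7 (f ∣[(2 : ℤ)] delta7⁻¹) (divPt 7 0 τ)
  rw [← SlashAction.slash_mul, inv_mul_cancel, SlashAction.slash_one] at h
  have h1 : mulPt 7 (divPt 7 0 τ) = τ := by
    apply UpperHalfPlane.ext
    simp [mulPt, divPt]
    field_simp
  rw [h1] at h
  rw [h]
  ring

/-- This bounds the dimension of the cusp space by 1: τ ↦ τ/7 carries f to `GD7`, where vanishing of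
a₀ and a₁ becomes vanishing to order 2 in exp(2πiτ/7). -/
theorem eq_zero_of_fourierCoeff_one_eq_zero (f : CuspForm (G0 49) 2)
    (h1 : fourierCoeff f 1 = 0) : f = 0 := by
  have hf := isBigO_of_fourierCoeff_one_eq_zero f h1
  let g : CuspForm GD7 2 := restrictCusp GD7_le_conj (CuspForm.translate f delta7⁻¹)
  have hg : ∀ τ, g τ = 7⁻¹ * f (divPt 7 0 τ) := slash_delta7_inv f
  have him : ∀ τ : ℍ, (divPt 7 0 τ).im = τ.im / 7 := by
    intro τ
    rw [← UpperHalfPlane.coe_im, ← UpperHalfPlane.coe_im]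
    simp only [divPt]
    rw [Complex.div_natCast_im]
    simp
  have ht : Tendsto (fun τ : ℍ => divPt 7 0 τ) atImInfty atImInfty := by
    refine tendsto_comap_iff.mpr ?_
    have : Tendsto (fun τ : ℍ => τ.im / 7) atImInfty atTop :=
      tendsto_comap.atTop_div_const (by norm_num)
    exact this.congr fun τ => (him τ).symm
  have hgO : g =O[atImInfty] fun τ : ℍ => Real.exp (-4 * Real.pi * τ.im / 7) := by
    refine ((hf.comp_tendsto ht).const_mul_left 7⁻¹).congr (fun τ => (hg τ).symm) fun τ => ?_
    rw [Function.comp_apply, him]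
    ring_nf
  have hg0 := eq_zero_of_isBigO g hgO
  ext τ
  have h2 := hg (mulPt 7 τ)
  have h3 : divPt 7 0 (mulPt 7 τ) = τ := by
    apply UpperHalfPlane.ext
    simp [mulPt, divPt]
  rw [hg0, h3] at h2
  have h4 : (7⁻¹ : ℂ) * f τ = 0 := h2.symm
  simpa using h4

theorem IsNewform.eq_formG {G : CuspForm (G0 49) 2} (hG : IsNewform 49 2 G) : G = formG := by
  rw [← sub_eq_zero]
  apply eq_zero_of_fourierCoeff_one_eq_zero
  have h : fourierCoeff (G - formG : CuspForm (G0 49) 2) =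
      fun n => fourierCoeff G n - fourierCoeff formG n :=
    coeff_unique (hasSum_fourierCoeff _) fun τ =>
      hasSum_of_eq ((hasSum_fourierCoeff G τ).sub (hasSum_fourierCoeff formG τ))
        (fun n => sub_mul _ _ _) rfl
  have h1 := congrFun h 1
  rwa [hG.normalised, isNewform_formG.normalised, sub_self] at h1

end

end CMTheta

end

theorem mainTheorem3 :
    (∃! G : CuspForm (CMTheta.G0 49) 2, CMTheta.IsNewform 49 2 G) ∧
    ∀ G : CuspForm (CMTheta.G0 49) 2, CMTheta.IsNewform 49 2 G →
      (∀ τ : UpperHalfPlane,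
        Summable (fun n : ℕ =>
          CMTheta.psiCoeff 7 CMTheta.chi7 (n + 1) * CMTheta.nome τ ^ (n + 1)) ∧
        CMTheta.Psi 7 CMTheta.chi7 τ =
          G τ - CMTheta.dilate 2 G τ + 4 * CMTheta.dilate 4 G τ) ∧
      ∀ p : ℕ, p.Prime → p ≠ 2 → p ≠ 7 →
        CMTheta.fourierCoeff G p = CMTheta.psiCoeff 7 CMTheta.chi7 p := by
  refine ⟨⟨CMTheta.formG, CMTheta.isNewform_formG, fun G hG => hG.eq_formG⟩, fun G hG => ?_⟩
  rw [hG.eq_formG]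
  refine ⟨fun τ => ⟨(CMTheta.hasSum_Psi τ).summable, (CMTheta.hasSum_Psi τ).tsum_eq⟩,
    fun p hp h2 _ => CMTheta.fourierCoeff_formG fun h => h2 ?_⟩
  exact ((Nat.prime_dvd_prime_iff_eq Nat.prime_two hp).mp h).symm
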